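/- Let $0<m\le L$ and $\alpha,\beta,\eta\in\mathbb{R}$. For a differentiable $f:\mathbb{R}^d\to\mathbb{R}$ consider the algorithm $$y_k = x_k+\eta(x_k-x_{k-1}),\qquad u_k=\nabla f(y_k),\qquad x_{k+1}=x_k+\beta(x_k-x_{k-1})-\alpha u_k\qquad(k\ge 0)$$ with initial conditions $x_0,x_{-1}\in\mathbb{R}^d$, and let $$g(z)=-\alpha\,\frac{(1+\eta)z-\eta}{(z-1)(z-\beta)}$$ be its transfer function from $u$ to $y$. Assume that the algorithm's realization of $g$ has no hidden mode on or outside the unit circle, i.e. $\alpha\neq0$, and $|\beta|<1$ in case $\eta=\beta(1+\eta)$ (this holds in particular whenever the realization is minimal). For a sequence $(h_k)_{k\in\mathbb{Z}}$ of reals with $h_k\ge0$ for all $k$ and $\|h\|_1=\sum_{k\in\mathbb{Z}}|h_k|\le1$, put $h(z)=\sum_{k\in\mathbb{Z}}h_kz^{-k}$ for $|z|=1$ and $$\Pi_{m,L}=\begin{bmatrix}-mL(2-h-h^*) & L(1-h^*)+m(1-h)\\ L(1-h)+m(1-h^*) & -(2-h-h^*)\end{bmatrix}.$$ Suppose that the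 rational function $\bigl(1-\tfrac{L+m}{2}g(z)\bigr)^{-1}$ is stable (proper, with all its poles in the open unit disk) and that, for some such $h$, the frequency-domain inequality $$\begin{bmatrix}g(z)\\1\end{bmatrix}^*\Pi_{m,L}(z)\begin{bmatrix}g(z)\\1\end{bmatrix}<0$$ holds for all $z$ with $|z|=1$ that are not poles of $g$. Then for every $d$ and every $f:\mathbb{R}^d\to\mathbb{R}$ that is $m$-strongly convex and differentiable with $L$-Lipschitz gradient, $f$ has a unique minimizer $x_\star$, and the algorithm is globally asymptotically stable: $(x_\star,x_\star)$ is a Lyapunov stable equilibrium of the iteration $(x_k,x_{k-1})\mapsto(x_{k+1},x_k)$, and $x_k\to x_\star$ for all initial conditions $x_0,x_{-1}\in\mathbb{R}^d$. -/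

import Mathlib

open Filter Topology
open scoped Matrix Gradient

noncomputable section

namespace GradAlg

/-- The class of `m`-strongly convex functions on `ℝᵈ` whose gradient is `L`-Lipschitz. -/
structure SmoothStronglyConvex {d : ℕ} (m L : ℝ) (f : EuclideanSpace ℝ (Fin d) → ℝ) : Prop where
  differentiable : Differentiable ℝ f
  lipschitz_gradient : ∀ x y, ‖∇ f x - ∇ f y‖ ≤ L * ‖x - y‖
  strongConvex : StrongConvexOn Set.univ m f

/-- One step `(x_k, x_{k-1}) ↦ (x_{k+1}, x_k)` of the algorithm
`y_k = x_k + η (x_k - x_{k-1})`, `u_k = ∇ f (y_k)`,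
`x_{k+1} = x_k + β (x_k - x_{k-1}) - α u_k`. -/
def step {d : ℕ} (α β η : ℝ) (f : EuclideanSpace ℝ (Fin d) → ℝ)
    (p : EuclideanSpace ℝ (Fin d) × EuclideanSpace ℝ (Fin d)) :
    EuclideanSpace ℝ (Fin d) × EuclideanSpace ℝ (Fin d) :=
  let y := p.1 + η • (p.1 - p.2)
  let u := ∇ f y
  (p.1 + β • (p.1 - p.2) - α • u, p.1)

/-- Global asymptotic stability of the point `p` for the discrete-time system `q_{k+1} = T q_k`:
`p` is an equilibrium, it is Lyapunov stable, and every trajectory converges to it. -/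
structure GloballyAsymptoticallyStable {X : Type*} [PseudoMetricSpace X] (T : X → X) (p : X) :
    Prop where
  equilibrium : T p = p
  stable : ∀ ε > 0, ∃ δ > 0, ∀ q, dist q p < δ → ∀ k : ℕ, dist (T^[k] q) p < ε
  attractive : ∀ q, Tendsto (fun k : ℕ => T^[k] q) atTop (𝓝 p)

/-- The transfer function `g(z) = -α ((1 + η) z - η) / ((z - 1) (z - β))`. -/
def transferFunction (α β η : ℝ) : RatFunc ℂ :=
  -RatFunc.C (α : ℂ) * (RatFunc.C (1 + η : ℂ) * RatFunc.X - RatFunc.C (η : ℂ)) /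
    ((RatFunc.X - 1) * (RatFunc.X - RatFunc.C (β : ℂ)))

/-- A discrete-time transfer function is stable if it is proper and all its poles (the roots of
the denominator in lowest terms) lie in the open unit disk. -/
structure IsStable (F : RatFunc ℂ) : Prop where
  proper : F.num.natDegree ≤ F.denom.natDegree
  poles : ∀ z : ℂ, F.denom.IsRoot z → ‖z‖ < 1

/-- Impulse responses `(h_k)`, `k ∈ ℤ`, with `h_k ≥ 0` and `‖h‖₁ ≤ 1`. -/
structure IsZamesFalb (h : ℤ → ℝ) : Prop where
  nonneg : ∀ k, 0 ≤ h k
  summable : Summable fun k => |h k|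
  norm_le_one : ∑' k, |h k| ≤ 1

/-- The transfer function `h(z) = ∑ h_k z^{-k}` of the impulse response `(h_k)`. -/
def zTransform (h : ℤ → ℝ) (z : ℂ) : ℂ := ∑' k : ℤ, (h k : ℂ) * z ^ (-k)

/-- The O'Shea–Zames–Falb multiplier `Π_{m,L}(z)` built from `h`. -/
def multiplier (m L : ℝ) (h : ℤ → ℝ) (z : ℂ) : Matrix (Fin 2) (Fin 2) ℂ :=
  let H := zTransform h z
  !![-(m * L) * (2 - H - star H), L * (1 - star H) + m * (1 - H);
     L * (1 - H) + m * (1 - star H), -(2 - H - star H)]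

/-- The frequency-domain inequality `[g; 1]* Π_{m,L} [g; 1] < 0` on the unit circle, required
wherever `g` is finite, i.e. at all points that are not poles of `g`. The left-hand side is real,
since `Π_{m,L}(z)` is Hermitian. -/
def FDI (m L : ℝ) (h : ℤ → ℝ) (g : RatFunc ℂ) : Prop :=
  ∀ z : ℂ, ‖z‖ = 1 → ¬ g.denom.IsRoot z →
    (star ![g.eval (RingHom.id ℂ) z, 1] ⬝ᵥ
      (multiplier m L h z *ᵥ ![g.eval (RingHom.id ℂ) z, 1])).re < 0

end GradAlg

end

/-! The proof runs on `ℓ²(ℤ)`: an a-priori gain bound comes from Zames–Falb, and a homotopy shows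
that trajectories really are square summable.

After translation to the minimizer, let `y` and `s` be the output and gradient sequences, `q = s - m
y`, `p = L y - s`. Cocoercivity gives a storage function `V ≥ 0` with `V(y_k) - V(y_{k-j}) ≤ ⟪q_k,
p_k - p_{k-j}⟫`. Summing over `k` kills the left side, and weighting by `h` gives `0 ≤ ⟪q, (1 - h)
p⟫` (`QuadraticBounds.zamesFalb`). Along the recursion with input `r`, `q` and `p` are Laurent
operators applied to the state `x`, up to multiples of `r`. The frequency inequality makes the part
quadratic in `x` at most `-c ‖x‖²` (`inner_laurentAct_le`), so `‖x‖ ≤ K ‖r‖` with one `K` for the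
whole class of gradients (`exists_gainBound`).

This bound presupposes `x ∈ ℓ²`. Stability of `(1 - (L+m)/2 · g)⁻¹` gives that for the gradient
`(L+m)/2 · y`. Since `K` is uniform, finitely many small steps carry it along the segment to the
true gradient (`L2Stable.perturb`, `l2Stable_of_gainBound`).

An initial condition is the effect of an input at two instants, so deviations from the minimizer lie
in `ℓ²`, with norm bounded by the initial distance; this yields attractivity and Lyapunov stability.
-/

namespace GradAlg

/-! ### Quadratic bounds, cocoercivity and the storage function -/

section Convex

variable {E : Type*} [NormedAddCommGroup E] [InnerProductSpace ℝ E]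

/-- `G` is a gradient field of `F`, where `F` lies between the quadratic lower and upper models of
curvature `m` and `L`. -/
structure QuadraticBounds (m L : ℝ) (F : E → ℝ) (G : E → E) : Prop where
  lower : ∀ a b, F b + inner ℝ (G b) (a - b) + m / 2 * ‖a - b‖ ^ 2 ≤ F a
  upper : ∀ a b, F a ≤ F b + inner ℝ (G b) (a - b) + L / 2 * ‖a - b‖ ^ 2

lemma QuadraticBounds.quadratic {m L κ : ℝ} (h₁ : m ≤ κ) (h₂ : κ ≤ L) :
    QuadraticBounds m L (fun x : E => κ / 2 * ‖x‖ ^ 2) (fun x => κ • x) := by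
  have key : ∀ a b : E, κ / 2 * ‖a‖ ^ 2
      = κ / 2 * ‖b‖ ^ 2 + inner ℝ (κ • b) (a - b) + κ / 2 * ‖a - b‖ ^ 2 := by
    intro a b
    rw [@norm_sub_sq_real, real_inner_smul_left, inner_sub_right, real_inner_self_eq_norm_sq,
      real_inner_comm]
    ring
  constructor <;> intro a b <;> rw [key a b] <;> gcongr

lemma QuadraticBounds.combination {m L t : ℝ} {F₁ F₂ : E → ℝ} {G₁ G₂ : E → E}
    (h₁ : QuadraticBounds m L F₁ G₁) (h₂ : QuadraticBounds m L F₂ G₂) (ht₀ : 0 ≤ t) (ht₁ : t ≤ 1) :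
    QuadraticBounds m L (fun x => (1 - t) * F₁ x + t * F₂ x)
      (fun x => (1 - t) • G₁ x + t • G₂ x) := by
  have ht : 0 ≤ 1 - t := by linarith
  constructor <;> intro a b <;> simp only [inner_add_left, real_inner_smul_left]
  · have := mul_le_mul_of_nonneg_left (h₁.lower a b) ht
    have := mul_le_mul_of_nonneg_left (h₂.lower a b) ht₀
    linarith
  · have := mul_le_mul_of_nonneg_left (h₁.upper a b) ht
    have := mul_le_mul_of_nonneg_left (h₂.upper a b) ht₀
    linarith

lemma QuadraticBounds.translate {m L : ℝ} {F : E → ℝ} {G : E → E}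
    (h : QuadraticBounds m L F G) (c : E) :
    QuadraticBounds m L (fun x => F (c + x)) (fun x => G (c + x)) := by
  constructor <;> intro a b
  · simpa using h.lower (c + a) (c + b)
  · simpa using h.upper (c + a) (c + b)

/-- The storage function of the pair `(G - m, L - G)`. -/
noncomputable def storage (m L : ℝ) (F : E → ℝ) (G : E → E) (a : E) : ℝ :=
  (L - m) * (F a - m / 2 * ‖a‖ ^ 2) - ‖G a - m • a‖ ^ 2 / 2

/-- For `M > 0` the best choice is `t = 1 / M`. The case `M = 0` is needed because `m = L` is
allowed. -/
lemma cocoercive_aux {A D M : ℝ} (hM : 0 ≤ M) (hD : 0 ≤ D)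
    (h : ∀ t : ℝ, A + t * D - M * t ^ 2 / 2 * D ≤ 0) : M * A + D / 2 ≤ 0 := by
  rcases hM.eq_or_lt with rfl | hM
  · rcases hD.eq_or_lt with rfl | hD
    · simp
    -- Here the hypothesis is affine in `t` with slope `D > 0`; this `t` makes its left side `1`.
    · have := h ((1 - A) / D)
      field_simp at this
      linarith
  · have := mul_le_mul_of_nonneg_left (h (1 / M)) hM.le
    field_simp at this
    nlinarith

/-- This is cocoercivity of the gradient of `F - m/2 ‖·‖²`, multiplied by `L - m` so that `L = m` is
harmless. It follows by comparing, at the point `b + t (qa - qb)`, the lower model based at `a` with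
the upper model based at `b`. -/
lemma QuadraticBounds.storage_sub_le {m L : ℝ} (hmL : m ≤ L) {F : E → ℝ} {G : E → E}
    (h : QuadraticBounds m L F G) (a b : E) :
    storage m L F G a - storage m L F G b
      ≤ inner ℝ (G a - m • a) ((L • a - G a) - (L • b - G b)) := by
  set qa := G a - m • a with hqa
  set qb := G b - m • b with hqb
  have hGa : G a = qa + m • a := by simp [hqa]
  have hGb : G b = qb + m • b := by simp [hqb]
  have key := cocoercive_aux (A := (F a - m / 2 * ‖a‖ ^ 2) - (F b - m / 2 * ‖b‖ ^ 2)
    - inner ℝ qa (a - b)) (D := ‖qa - qb‖ ^ 2) (sub_nonneg.2 hmL) (sq_nonneg _) (by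
      intro t
      have h1 := h.lower (b + t • (qa - qb)) a
      have h2 := h.upper (b + t • (qa - qb)) b
      have h3 := h1.trans h2
      rw [hGa, hGb] at h3
      simp only [← real_inner_self_eq_norm_sq, inner_add_left, inner_add_right, inner_sub_left,
        inner_sub_right, real_inner_smul_left, real_inner_smul_right] at h3 ⊢
      rw [real_inner_comm qa qb, real_inner_comm a b, real_inner_comm qa a, real_inner_comm qa b,
        real_inner_comm qb a, real_inner_comm qb b] at *
      linarith)
  have : L • a - G a - (L • b - G b) = (L - m) • (a - b) - (qa - qb) := by
    rw [hGa, hGb]; module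
  rw [this]
  simp only [storage, ← hqa, ← hqb]
  simp only [← real_inner_self_eq_norm_sq, inner_sub_left, inner_sub_right,
    real_inner_smul_right] at key ⊢
  rw [real_inner_comm qa qb] at *
  linarith

end Convex

/-! ### First-order characterizations of smoothness and strong convexity -/

section Gradient

variable {E : Type*} [NormedAddCommGroup E] [InnerProductSpace ℝ E] [CompleteSpace E]

lemma hasDerivAt_comp_line {f : E → ℝ} (hf : Differentiable ℝ f) (b v : E) (t : ℝ) :
    HasDerivAt (fun s : ℝ => f (b + s • v)) (inner ℝ (∇ f (b + t • v)) v) t := by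
  have h1 : HasFDerivAt f _ (b + t • v) := (hf (b + t • v)).hasGradientAt.hasFDerivAt
  have h2 : HasDerivAt (fun s : ℝ => b + s • v) v t := by
    simpa using ((hasDerivAt_id t).smul_const v).const_add b
  exact (h1.comp_hasDerivAt t h2).congr_deriv (by simp)

lemma le_of_lipschitz_gradient {f : E → ℝ} {L : ℝ} (hf : Differentiable ℝ f)
    (hL : ∀ x y, ‖∇ f x - ∇ f y‖ ≤ L * ‖x - y‖) (a b : E) :
    f a ≤ f b + inner ℝ (∇ f b) (a - b) + L / 2 * ‖a - b‖ ^ 2 := by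
  set v := a - b with hv
  have hd : ∀ t : ℝ, HasDerivAt (fun s : ℝ => f (b + s • v) - s * inner ℝ (∇ f b) v
      - L / 2 * s ^ 2 * ‖v‖ ^ 2)
      (inner ℝ (∇ f (b + t • v)) v - inner ℝ (∇ f b) v - L * t * ‖v‖ ^ 2) t := by
    intro t
    have h1 := hasDerivAt_comp_line hf b v t
    have h2 : HasDerivAt (fun s : ℝ => s * inner ℝ (∇ f b) v) (inner ℝ (∇ f b) v) t := by
      simpa using (hasDerivAt_id t).mul_const (inner ℝ (∇ f b) v)
    have h3 : HasDerivAt (fun s : ℝ => L / 2 * s ^ 2 * ‖v‖ ^ 2) (L * t * ‖v‖ ^ 2) t := by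
      have := (((hasDerivAt_id t).pow 2).const_mul (L / 2)).mul_const (‖v‖ ^ 2)
      refine this.congr_deriv ?_
      push_cast; simp only [id]; ring
    exact (h1.sub h2).sub h3
  have hanti : AntitoneOn (fun s : ℝ => f (b + s • v) - s * inner ℝ (∇ f b) v
      - L / 2 * s ^ 2 * ‖v‖ ^ 2) (Set.Icc 0 1) := by
    refine antitoneOn_of_deriv_nonpos (convex_Icc 0 1)
      (fun t _ => (hd t).continuousAt.continuousWithinAt)
      (fun t _ => (hd t).differentiableAt.differentiableWithinAt) ?_
    intro t ht
    rw [interior_Icc] at ht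
    rw [(hd t).deriv, ← inner_sub_left]
    have h1 := real_inner_le_norm (∇ f (b + t • v) - ∇ f b) v
    have h2 := hL (b + t • v) b
    rw [add_sub_cancel_left, norm_smul, Real.norm_of_nonneg ht.1.le] at h2
    nlinarith [norm_nonneg v]
  have := hanti (Set.left_mem_Icc.2 zero_le_one) (Set.right_mem_Icc.2 zero_le_one) zero_le_one
  simp [hv] at this ⊢
  linarith

lemma _root_.ConvexOn.add_inner_gradient_le {f : E → ℝ} (hf : Differentiable ℝ f)
    (hc : ConvexOn ℝ Set.univ f) (a b : E) : f b + inner ℝ (∇ f b) (a - b) ≤ f a := by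
  have hd := hasDerivAt_comp_line hf b (a - b) 0
  have hc' : ConvexOn ℝ Set.univ (fun s : ℝ => f (b + s • (a - b))) := by
    have := hc.comp_affineMap (AffineMap.lineMap b a)
    simpa [Function.comp_def, AffineMap.lineMap_apply, add_comm] using this
  have := hc'.le_slope_of_hasDerivAt (Set.mem_univ 0) (Set.mem_univ 1) zero_lt_one hd
  simp [slope_def_field] at this ⊢
  linarith

lemma _root_.StrongConvexOn.add_inner_gradient_le {f : E → ℝ} {m : ℝ} (hf : Differentiable ℝ f)
    (hc : StrongConvexOn Set.univ m f) (a b : E) :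
    f b + inner ℝ (∇ f b) (a - b) + m / 2 * ‖a - b‖ ^ 2 ≤ f a := by
  have hc' := strongConvexOn_iff_convex.1 hc
  have hg : ∀ x, HasGradientAt (fun x => f x - m / 2 * ‖x‖ ^ 2) (∇ f x - m • x) x := by
    intro x
    rw [hasGradientAt_iff_hasFDerivAt]
    have h1 := (hf x).hasGradientAt.hasFDerivAt
    have h2 := ((hasStrictFDerivAt_norm_sq x).hasFDerivAt).const_mul (m / 2)
    refine (h1.sub h2).congr_fderiv ?_
    ext v
    simp
    ring
  have := ConvexOn.add_inner_gradient_le (fun x => (hg x).differentiableAt) hc' a b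
  rw [(hg b).gradient] at this
  simp only [← real_inner_self_eq_norm_sq, inner_sub_left, inner_sub_right,
    real_inner_smul_left] at this ⊢
  rw [real_inner_comm a b] at *
  linarith

end Gradient

/-! ### The function class: quadratic bounds and the minimizer -/

lemma SmoothStronglyConvex.quadraticBounds {d : ℕ} {m L : ℝ} {f : EuclideanSpace ℝ (Fin d) → ℝ}
    (hf : SmoothStronglyConvex m L f) : QuadraticBounds m L f (∇ f) :=
  ⟨hf.strongConvex.add_inner_gradient_le hf.differentiable,
    le_of_lipschitz_gradient hf.differentiable hf.lipschitz_gradient⟩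

lemma SmoothStronglyConvex.exists_minimizer {d : ℕ} {m L : ℝ} (hm : 0 < m)
    {f : EuclideanSpace ℝ (Fin d) → ℝ} (hf : SmoothStronglyConvex m L f) :
    ∃ xs, ∇ f xs = 0 ∧ ∀ x, x ≠ xs → f xs < f x := by
  have hlow := hf.quadraticBounds.lower
  have hlim : Tendsto f (cocompact _) atTop := by
    have h1 : Tendsto (fun t : ℝ => f 0 + t * (m / 2 * t + -‖∇ f 0‖)) atTop atTop := by
      refine tendsto_atTop_add_const_left _ _ (tendsto_id.atTop_mul_atTop₀ ?_)
      exact tendsto_atTop_add_const_right _ _ (tendsto_id.const_mul_atTop (by positivity))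
    refine tendsto_atTop_mono (fun x => ?_) (h1.comp (tendsto_norm_cocompact_atTop
      (E := EuclideanSpace ℝ (Fin d))))
    have h2 := hlow x 0
    have h3 := neg_le_of_abs_le (abs_real_inner_le_norm (∇ f 0) x)
    simp only [sub_zero] at h2
    simp only [Function.comp]
    nlinarith
  obtain ⟨xs, hxs⟩ := hf.differentiable.continuous.exists_forall_le hlim
  have hg : ∇ f xs = 0 := by
    have : IsLocalMin f xs := Filter.Eventually.of_forall hxs
    rw [gradient, this.fderiv_eq_zero, map_zero]
  refine ⟨xs, hg, fun x hx => ?_⟩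
  have := hlow x xs
  rw [hg, inner_zero_left] at this
  have h4 : 0 < ‖x - xs‖ := norm_pos_iff.2 (sub_ne_zero.2 hx)
  have : 0 < m / 2 * ‖x - xs‖ ^ 2 := by positivity
  linarith

/-! ### Laurent polynomials as shift operators on `ℓ²(ℤ)` -/

section Shift

open LaurentPolynomial

variable {E : Type*} [NormedAddCommGroup E]

/-- Square-summable two-sided sequences in `E`. -/
abbrev SeqL2 (E : Type*) [NormedAddCommGroup E] : Type _ := lp (fun _ : ℤ => E) 2

lemma memℓp_two_iff {ι F : Type*} [NormedAddCommGroup F] {x : ι → F} :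
    Memℓp x 2 ↔ Summable fun k => ‖x k‖ ^ 2 := by
  rw [memℓp_gen_iff (by norm_num)]
  simp

lemma SeqL2.hasSum_norm_sq (x : SeqL2 E) : HasSum (fun k => ‖x k‖ ^ 2) (‖x‖ ^ 2) := by
  simpa using lp.hasSum_norm (p := 2) (by norm_num) x

@[simp] lemma SeqL2.add_apply (x y : SeqL2 E) (k : ℤ) : (x + y) k = x k + y k := rfl

@[simp] lemma SeqL2.sub_apply (x y : SeqL2 E) (k : ℤ) : (x - y) k = x k - y k := rfl

lemma memℓp_comp_sub (n : ℤ) {x : ℤ → E} (hx : Memℓp x 2) : Memℓp (fun k => x (k - n)) 2 :=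
  memℓp_two_iff.2 ((Equiv.subRight n).summable_iff.2 (memℓp_two_iff.1 hx))

/-- The sequence `k ↦ x_{k-n}`. -/
def shiftSeq (n : ℤ) (x : SeqL2 E) : SeqL2 E :=
  ⟨fun k => x (k - n), memℓp_comp_sub n (lp.memℓp x)⟩

lemma norm_shiftSeq (n : ℤ) (x : SeqL2 E) : ‖shiftSeq n x‖ = ‖x‖ := by
  refine (sq_eq_sq₀ (norm_nonneg _) (norm_nonneg _)).1 ?_
  have h := (Equiv.subRight n).hasSum_iff.2 (SeqL2.hasSum_norm_sq x)
  exact (SeqL2.hasSum_norm_sq (shiftSeq n x)).unique h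

variable [InnerProductSpace ℝ E]

@[simp] lemma SeqL2.smul_apply (c : ℝ) (x : SeqL2 E) (k : ℤ) : (c • x) k = c • x k := rfl

/-- The shift `(S_n x)_k = x_{k-n}` on square-summable sequences. -/
noncomputable def shift (n : ℤ) : SeqL2 E →ₗᵢ[ℝ] SeqL2 E where
  toFun := shiftSeq n
  map_add' _ _ := rfl
  map_smul' _ _ := rfl
  norm_map' := norm_shiftSeq n

@[simp] lemma shift_apply (n : ℤ) (x : SeqL2 E) (k : ℤ) : shift n x k = x (k - n) := rfl

lemma shift_single (n k : ℤ) (v : E) :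
    shift n (lp.single 2 k v : SeqL2 E) = lp.single 2 (k + n) v := by
  ext j
  simp only [shift_apply, lp.single_apply, Pi.single_apply]
  congr 1
  simp [sub_eq_iff_eq_add]

lemma inner_shift_left (n : ℤ) (x y : SeqL2 E) :
    inner ℝ (shift n x) y = inner ℝ x (shift (-n) y) := by
  rw [← (shift (E := E) (-n)).inner_map_map]
  congr 1
  ext k
  simp

/-- Laurent polynomials act on square-summable sequences, `T n` being the shift by `n`. -/
noncomputable def laurentAct (E : Type*) [NormedAddCommGroup E] [InnerProductSpace ℝ E] :
    ℝ[T;T⁻¹] →ₐ[ℝ] (SeqL2 E →L[ℝ] SeqL2 E) :=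
  AddMonoidAlgebra.lift ℝ (SeqL2 E →L[ℝ] SeqL2 E) ℤ
    { toFun := fun n => (shift n.toAdd).toContinuousLinearMap
      map_one' := by ext x k; simp
      map_mul' := fun a b => by ext x k; simp [sub_sub] }

@[simp] lemma laurentAct_T (n : ℤ) (x : SeqL2 E) : laurentAct E (T n) x = shift n x := by
  rw [T, laurentAct, AddMonoidAlgebra.lift_single, one_smul]; rfl

@[simp] lemma laurentAct_C (c : ℝ) (x : SeqL2 E) : laurentAct E (C c) x = c • x := by
  rw [C_eq_algebraMap, AlgHom.commutes]; rfl

/-- Evaluation of a Laurent polynomial on the unit circle, with `T n ↦ z⁻ⁿ`. -/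
noncomputable def laurentEval (z : Circle) : ℝ[T;T⁻¹] →ₐ[ℝ] ℂ :=
  AddMonoidAlgebra.lift ℝ ℂ ℤ
    { toFun := fun n => (z : ℂ) ^ (-n.toAdd)
      map_one' := by simp
      map_mul' := fun a b => by
        simp [zpow_add₀ (Circle.coe_ne_zero z), mul_comm] }

@[simp] lemma laurentEval_T (z : Circle) (n : ℤ) : laurentEval z (T n) = (z : ℂ) ^ (-n) := by
  rw [T, laurentEval, AddMonoidAlgebra.lift_single, one_smul]; rfl

@[simp] lemma laurentEval_C (z : Circle) (c : ℝ) : laurentEval z (C c) = c := by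
  rw [C_eq_algebraMap, AlgHom.commutes]; rfl

/-- Coefficients are real and `|z| = 1`, so `T ↦ T⁻¹` conjugates the symbol, just as it produces the
adjoint operator in `inner_laurentAct_left`. -/
lemma laurentEval_invert (z : Circle) (P : ℝ[T;T⁻¹]) :
    laurentEval z (invert P) = star (laurentEval z P) := by
  induction P using LaurentPolynomial.induction_on' with
  | add p q hp hq => simp only [map_add, hp, hq, star_add]
  | C_mul_T n a =>
    have : star (z : ℂ) = (z : ℂ)⁻¹ := by rw [← Circle.coe_inv, Circle.coe_inv_eq_conj]; rfl
    simp [this]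

lemma inner_laurentAct_left (P : ℝ[T;T⁻¹]) (x y : SeqL2 E) :
    inner ℝ (laurentAct E P x) y = inner ℝ x (laurentAct E (invert P) y) := by
  induction P using LaurentPolynomial.induction_on' with
  | add p q hp hq => simp only [map_add, _root_.add_apply, inner_add_left,
      inner_add_right, hp, hq]
  | C_mul_T n a => simp [real_inner_smul_left, real_inner_smul_right, inner_shift_left]

lemma inner_laurentAct_laurentAct (P Q : ℝ[T;T⁻¹]) (x : SeqL2 E) :
    inner ℝ (laurentAct E P x) (laurentAct E Q x)
      = inner ℝ x (laurentAct E (invert P * Q) x) := by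
  rw [inner_laurentAct_left, map_mul]; rfl

end Shift

/-! ### Parseval: bounding a Laurent operator by its symbol -/

section Parseval

open MeasureTheory intervalIntegral LaurentPolynomial

lemma integral_circleExp_zpow (n : ℤ) :
    ∫ θ in (0 : ℝ)..(2 * Real.pi), ((Circle.exp θ : Circle) : ℂ) ^ n
      = if n = 0 then (2 * Real.pi : ℂ) else 0 := by
  split_ifs with h
  · simp [h]
  · have : ∀ θ : ℝ, ((Circle.exp θ : Circle) : ℂ) ^ n = Complex.exp ((n * Complex.I) * θ) := by
      intro θ
      rw [Circle.coe_exp, ← Complex.exp_int_mul]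
      ring_nf
    simp_rw [this]
    rw [integral_exp_mul_complex (by simp [h])]
    have h2 : Complex.exp (n * Complex.I * ((2 * Real.pi : ℝ) : ℂ)) = 1 := by
      rw [← Complex.exp_int_mul_two_pi_mul_I n]
      congr 1; push_cast; ring
    simp only [h2]; simp

@[fun_prop]
lemma continuous_circleExp_zpow (n : ℤ) :
    Continuous fun θ : ℝ => ((Circle.exp θ : Circle) : ℂ) ^ n := by
  exact Continuous.zpow₀ (by fun_prop) n fun θ => Or.inl (Circle.coe_ne_zero _)

@[fun_prop]
lemma continuous_laurentEval (P : ℝ[T;T⁻¹]) :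
    Continuous fun θ : ℝ => laurentEval (Circle.exp θ) P := by
  induction P using LaurentPolynomial.induction_on' with
  | add p q hp hq => simp only [map_add]; exact Continuous.add hp hq
  | C_mul_T n a =>
    simp only [map_mul, laurentEval_C, laurentEval_T]
    fun_prop

variable {d : ℕ}

/-- The trigonometric polynomial `∑ v_{k,i} z^k`. -/
noncomputable def trigPoly (s : Finset ℤ) (v : ℤ → EuclideanSpace ℝ (Fin d)) (i : Fin d)
    (z : Circle) : ℂ :=
  ∑ k ∈ s, (v k i : ℂ) * (z : ℂ) ^ k

/-- The energy density `∑ᵢ |∑ₖ v_{k,i} z^k|²`. -/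
noncomputable def spectralEnergy (s : Finset ℤ) (v : ℤ → EuclideanSpace ℝ (Fin d))
    (z : Circle) : ℝ :=
  ∑ i, Complex.normSq (trigPoly s v i z)

lemma spectralEnergy_nonneg (s : Finset ℤ) (v : ℤ → EuclideanSpace ℝ (Fin d)) (z : Circle) :
    0 ≤ spectralEnergy s v z := Finset.sum_nonneg fun _ _ => Complex.normSq_nonneg _

lemma spectralEnergy_eq (s : Finset ℤ) (v : ℤ → EuclideanSpace ℝ (Fin d)) (z : Circle) :
    (spectralEnergy s v z : ℂ)
      = ∑ k ∈ s, ∑ l ∈ s, ((inner ℝ (v k) (v l) : ℝ) : ℂ) * (z : ℂ) ^ (k - l) := by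
  have hz : star (z : ℂ) = (z : ℂ)⁻¹ := by rw [← Circle.coe_inv, Circle.coe_inv_eq_conj]; rfl
  have h1 : ∀ i, ((Complex.normSq (trigPoly s v i z) : ℝ) : ℂ)
      = ∑ k ∈ s, ∑ l ∈ s, ((v l i * v k i : ℝ) : ℂ) * (z : ℂ) ^ (k - l) := by
    intro i
    rw [← Complex.mul_conj, trigPoly, map_sum, Finset.sum_mul_sum]
    refine Finset.sum_congr rfl fun k _ => Finset.sum_congr rfl fun l _ => ?_
    rw [map_mul, Complex.conj_ofReal, map_zpow₀, starRingEnd_apply, hz, inv_zpow', zpow_sub₀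
      (Circle.coe_ne_zero z), zpow_neg]
    push_cast
    ring
  simp only [spectralEnergy, Complex.ofReal_sum, h1]
  rw [Finset.sum_comm]
  refine Finset.sum_congr rfl fun k _ => ?_
  rw [Finset.sum_comm]
  refine Finset.sum_congr rfl fun l _ => ?_
  rw [← Finset.sum_mul]
  simp [PiLp.inner_apply]

@[fun_prop]
lemma continuous_spectralEnergy (s : Finset ℤ) (v : ℤ → EuclideanSpace ℝ (Fin d)) :
    Continuous fun θ : ℝ => spectralEnergy s v (Circle.exp θ) := by
  unfold spectralEnergy trigPoly
  refine continuous_finsetSum _ fun i _ => Complex.continuous_normSq.comp ?_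
  fun_prop

/-- For `P = T n`, orthogonality of the characters keeps only the pairs `k = l + n` of the energy,
which are the terms of `⟪x, S_n x⟫`. -/
lemma inner_laurentAct_sum_single (s : Finset ℤ) (v : ℤ → EuclideanSpace ℝ (Fin d))
    (P : ℝ[T;T⁻¹]) :
    ∫ θ in (0 : ℝ)..(2 * Real.pi),
        laurentEval (Circle.exp θ) P * (spectralEnergy s v (Circle.exp θ) : ℂ)
      = 2 * Real.pi * ((inner ℝ (∑ k ∈ s, lp.single 2 k (v k) : SeqL2 (EuclideanSpace ℝ (Fin d)))
          (laurentAct _ P (∑ k ∈ s, lp.single 2 k (v k))) : ℝ) : ℂ) := by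
  induction P using LaurentPolynomial.induction_on' with
  | add p q hp hq =>
    simp only [map_add, _root_.add_apply, inner_add_right, add_mul,
      Complex.ofReal_add, mul_add]
    rw [intervalIntegral.integral_add, hp, hq] <;>
      exact Continuous.intervalIntegrable (by fun_prop) _ _
  | C_mul_T n a =>
    have h1 : ∀ θ : ℝ, laurentEval (Circle.exp θ) (C a * T n)
        * (spectralEnergy s v (Circle.exp θ) : ℂ) = ∑ k ∈ s, ∑ l ∈ s,
          ((a * inner ℝ (v k) (v l) : ℝ) : ℂ) * ((Circle.exp θ : Circle) : ℂ) ^ (k - (l + n)) := by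
      intro θ
      rw [spectralEnergy_eq, Finset.mul_sum]
      refine Finset.sum_congr rfl fun k _ => ?_
      rw [Finset.mul_sum]
      refine Finset.sum_congr rfl fun l _ => ?_
      rw [← sub_sub, sub_eq_add_neg (k - l), zpow_add₀ (Circle.coe_ne_zero _)]
      simp only [map_mul, laurentEval_C, laurentEval_T]
      push_cast
      ring
    simp_rw [h1]
    rw [intervalIntegral.integral_finsetSum
      (fun _ _ => Continuous.intervalIntegrable (by fun_prop) _ _)]
    simp only [map_mul, mul_apply_eq_comp, laurentAct_C, laurentAct_T, map_sum,
      shift_single, inner_smul_right, sum_inner, inner_sum, lp.inner_single_left, lp.single_apply]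
    simp only [Complex.ofReal_mul, Complex.ofReal_sum, Finset.mul_sum]
    rw [Finset.sum_comm]
    refine Finset.sum_congr rfl fun k _ => ?_
    rw [intervalIntegral.integral_finsetSum
      (fun _ _ => Continuous.intervalIntegrable (by fun_prop) _ _)]
    refine Finset.sum_congr rfl fun l _ => ?_
    rw [intervalIntegral.integral_const_mul, integral_circleExp_zpow, Pi.single_apply]
    by_cases h : k = l + n
    · simp [h]; ring
    · simp [h, sub_eq_zero]

/-- A Laurent operator is bounded above by the supremum of the real part of its symbol. -/
lemma inner_laurentAct_le {P : ℝ[T;T⁻¹]} {M : ℝ} (hP : ∀ z : Circle, (laurentEval z P).re ≤ M)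
    (x : SeqL2 (EuclideanSpace ℝ (Fin d))) :
    inner ℝ x (laurentAct _ P x) ≤ M * ‖x‖ ^ 2 := by
  -- For finite truncations both sides are integrals against the nonnegative spectral energy, the
  -- right one being Parseval with symbol `1`; the general case follows by continuity.
  have hfin : ∀ s : Finset ℤ, inner ℝ (∑ k ∈ s, lp.single 2 k (x k))
      (laurentAct _ P (∑ k ∈ s, lp.single 2 k (x k)))
        ≤ M * ‖(∑ k ∈ s, lp.single 2 k (x k) : SeqL2 (EuclideanSpace ℝ (Fin d)))‖ ^ 2 := by
    intro s
    set X := (∑ k ∈ s, lp.single 2 k (x k) : SeqL2 (EuclideanSpace ℝ (Fin d))) with hX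
    have h1 := inner_laurentAct_sum_single s x P
    have h2 := inner_laurentAct_sum_single s x 1
    rw [← hX] at h1 h2
    simp only [map_one, one_apply_eq_self, one_mul,
      real_inner_self_eq_norm_sq] at h2
    have h3 := congrArg Complex.re h1
    have h4 := congrArg Complex.re h2
    have hre : ∀ F : ℝ → ℂ, Continuous F →
        (∫ θ in (0 : ℝ)..(2 * Real.pi), F θ).re = ∫ θ in (0 : ℝ)..(2 * Real.pi), (F θ).re := by
      intro F hF
      exact (Complex.reCLM.intervalIntegral_comp_comm (hF.intervalIntegrable _ _)).symm
    rw [hre _ (by fun_prop)] at h3 h4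
    have h5 : ∀ r : ℝ, (2 * (Real.pi : ℂ) * (r : ℂ)).re = 2 * Real.pi * r := by
      intro r; norm_cast
    rw [h5] at h3 h4
    simp only [Complex.re_mul_ofReal, Complex.ofReal_re] at h3 h4
    have h6 : ∫ θ in (0 : ℝ)..(2 * Real.pi),
        (laurentEval (Circle.exp θ) P).re * spectralEnergy s x (Circle.exp θ)
        ≤ ∫ θ in (0 : ℝ)..(2 * Real.pi), M * spectralEnergy s x (Circle.exp θ) := by
      refine intervalIntegral.integral_mono_on (by positivity) ?_ ?_ ?_
      · exact Continuous.intervalIntegrable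
          ((Complex.continuous_re.comp (continuous_laurentEval P)).mul
            (continuous_spectralEnergy s x)) _ _
      · exact Continuous.intervalIntegrable (by fun_prop) _ _
      · exact fun θ _ => mul_le_mul_of_nonneg_right (hP _) (spectralEnergy_nonneg _ _ _)
    rw [intervalIntegral.integral_const_mul, h3, h4] at h6
    have := Real.pi_pos
    nlinarith
  have hlim := lp.hasSum_single (p := 2) (by norm_num) x
  have hc1 : Continuous fun X : SeqL2 (EuclideanSpace ℝ (Fin d)) =>
      inner ℝ X (laurentAct _ P X) := by fun_prop
  have hc2 : Continuous fun X : SeqL2 (EuclideanSpace ℝ (Fin d)) => M * ‖X‖ ^ 2 := by fun_prop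
  exact le_of_tendsto_of_tendsto' ((hc1.tendsto x).comp hlim) ((hc2.tendsto x).comp hlim) hfin

end Parseval

/-! ### The Zames–Falb inequality -/

section ZamesFalb

variable {E : Type*} [NormedAddCommGroup E] [InnerProductSpace ℝ E]

/-- The Zames–Falb inequality for gradient fields of smooth strongly convex functions. -/
lemma QuadraticBounds.zamesFalb {m L : ℝ} (hmL : m ≤ L) {F : E → ℝ} {G : E → E}
    (hFG : QuadraticBounds m L F G) (hG : G 0 = 0) {J : Finset ℤ} {h : ℤ → ℝ}
    (h₀ : ∀ j, 0 ≤ h j) (h₁ : ∑ j ∈ J, h j ≤ 1) (y s : SeqL2 E) (hs : ∀ k, s k = G (y k)) :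
    0 ≤ inner ℝ (s - m • y) (L • y - s)
      - ∑ j ∈ J, h j * inner ℝ (s - m • y) (shift j (L • y - s)) := by
  set q := s - m • y with hq
  set p := L • y - s with hp
  set V := fun a => storage m L F G a - storage m L F G 0 with hV
  have hqk : ∀ k, q k = G (y k) - m • y k := fun k => by
    simp only [hq, hs, SeqL2.sub_apply, SeqL2.smul_apply]
  have hpk : ∀ k, p k = L • y k - G (y k) := fun k => by
    simp only [hp, hs, SeqL2.sub_apply, SeqL2.smul_apply]
  have hV0 : ∀ a, 0 ≤ V a := fun a => by
    have := hFG.storage_sub_le hmL 0 a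
    simp [hG] at this
    simp only [hV]; linarith
  have hVle : ∀ k, V (y k) ≤ inner ℝ (q k) (p k) := fun k => by
    have := hFG.storage_sub_le hmL (y k) 0
    simpa [hG, hqk, hpk, hV] using this
  have hsum := lp.hasSum_inner (𝕜 := ℝ) q p
  have hVs : Summable fun k => V (y k) := .of_nonneg_of_le (fun k => hV0 _) hVle hsum.summable
  have hqp : 0 ≤ inner ℝ q p := hsum.nonneg fun k => (hV0 _).trans (hVle k)
  -- The storage inequality between `y_k` and `y_{k-j}` is summed over `k`. As `V (y k)` is
  -- summable, its sum is shift invariant and the storage differences add up to zero, for either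
  -- sign of `j`.
  have hj : ∀ j, inner ℝ q (shift j p) ≤ inner ℝ q p := by
    intro j
    have h2 := hsum.sub (lp.hasSum_inner (𝕜 := ℝ) q (shift j p))
    have h3 := hVs.hasSum.sub ((Equiv.subRight j).hasSum_iff.2 hVs.hasSum)
    have h4 := hasSum_le (fun k => ?_) h3 h2
    · linarith
    · have := hFG.storage_sub_le hmL (y k) (y (k - j))
      rw [← inner_sub_right, shift_apply, hpk, hpk, hqk]
      simpa [hV] using this
  have h5 : ∑ j ∈ J, h j * inner ℝ q (shift j p) ≤ ∑ j ∈ J, h j * inner ℝ q p :=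
    Finset.sum_le_sum fun j _ => mul_le_mul_of_nonneg_left (hj j) (h₀ j)
  rw [← Finset.sum_mul] at h5
  nlinarith

end ZamesFalb

/-! ### From the frequency-domain inequality to a uniform bound on symbols -/

section Frequency

open Polynomial in
lemma transferFunction_eq_div (α β η : ℝ) :
    transferFunction α β η = algebraMap ℂ[X] (RatFunc ℂ)
        (-(C (α : ℂ)) * (C (1 + η : ℂ) * X - C (η : ℂ))) /
      algebraMap ℂ[X] (RatFunc ℂ) ((X - 1) * (X - C (β : ℂ))) := by
  simp [transferFunction, RatFunc.algebraMap_C, RatFunc.algebraMap_X]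

open Polynomial in
lemma X_sub_one_mul_X_sub_C_ne_zero (b : ℂ) : (X - 1 : ℂ[X]) * (X - C b) ≠ 0 :=
  mul_ne_zero (by simpa using X_sub_C_ne_zero (1 : ℂ)) (X_sub_C_ne_zero b)

open Polynomial in
lemma transferFunction_eval (α β η : ℝ) {z : ℂ} (hz : (z - 1) * (z - β) ≠ 0) :
    ¬ (transferFunction α β η).denom.IsRoot z ∧
      (transferFunction α β η).eval (RingHom.id ℂ) z
        = -α * ((1 + η) * z - η) / ((z - 1) * (z - β)) := by
  set g := transferFunction α β η with hg
  have hq := X_sub_one_mul_X_sub_C_ne_zero (β : ℂ)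
  have key := (RatFunc.num_mul_eq_mul_denom_iff hq).2 (hg.trans (transferFunction_eq_div α β η))
  have hdvd := (RatFunc.denom_dvd hq).2 ⟨_, hg.trans (transferFunction_eq_div α β η)⟩
  have hroot : g.denom.eval z ≠ 0 := by
    intro h0
    have := eval_eq_zero_of_dvd_of_eval_eq_zero hdvd h0
    simp at this
    exact hz (by simpa using this)
  refine ⟨hroot, ?_⟩
  have := congrArg (eval z) key
  simp only [eval_mul, eval_sub, eval_X, eval_one, eval_C, eval_neg] at this
  rw [RatFunc.eval, eval₂_id, eval₂_id, div_eq_div_iff hroot hz, this]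

open Polynomial in
/-- The characteristic polynomial of the loop closed with gain `κ` has its roots in the open
unit disk. -/
lemma norm_lt_one_of_charpoly_root {α β η κ : ℝ} (hα : α ≠ 0) (hκ : κ ≠ 0)
    (hβ : η = β * (1 + η) → |β| < 1)
    (hstable : IsStable (1 - RatFunc.C (κ : ℂ) * transferFunction α β η)⁻¹) {z : ℂ}
    (hz : (z - 1) * (z - β) + κ * α * ((1 + η) * z - η) = 0) : ‖z‖ < 1 := by
  set q : ℂ[X] := (X - 1) * (X - C (β : ℂ)) with hqdef
  set c : ℂ[X] := q + C (κ : ℂ) * (C (α : ℂ) * (C (1 + η : ℂ) * X - C (η : ℂ))) with hcdef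
  have hq : q ≠ 0 := X_sub_one_mul_X_sub_C_ne_zero (β : ℂ)
  have hqm : q.Monic := by
    rw [hqdef]; exact (by simpa using monic_X_sub_C (1 : ℂ) : (X - 1 : ℂ[X]).Monic).mul
      (monic_X_sub_C _)
  have hqdeg : q.degree = 2 := by
    rw [hqdef, degree_mul, degree_X_sub_C, show (1 : ℂ[X]) = C 1 by simp, degree_X_sub_C]; rfl
  have hc : c ≠ 0 := by
    intro h0
    have h1 : c.coeff 2 = 1 := by
      have h2 : q.coeff 2 = 1 := by
        have := hqm.coeff_natDegree
        rwa [natDegree_eq_of_degree_eq_some hqdeg] at this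
      simp [hcdef, h2, show (1 : ℂ[X]).coeff 1 = 0 by simp [coeff_one]]
    rw [h0] at h1
    simp at h1
  set F := (1 - RatFunc.C (κ : ℂ) * transferFunction α β η)⁻¹ with hF
  have hFeq : F = algebraMap ℂ[X] (RatFunc ℂ) q / algebraMap ℂ[X] (RatFunc ℂ) c := by
    have hq' : algebraMap ℂ[X] (RatFunc ℂ) q ≠ 0 := RatFunc.algebraMap_ne_zero hq
    rw [hF, transferFunction_eq_div, ← hqdef, inv_eq_iff_eq_inv, inv_div]
    rw [eq_div_iff hq', sub_mul, mul_assoc, div_mul_cancel₀ _ hq', hcdef]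
    simp only [map_add, map_mul, map_neg, RatFunc.algebraMap_C]
    ring
  have key := (RatFunc.num_mul_eq_mul_denom_iff hc).2 hFeq
  have hev := congrArg (eval z) key
  have hcz : c.eval z = 0 := by
    rw [← hz]; simp [hcdef, hqdef]; ring
  rw [eval_mul, eval_mul, hcz, mul_zero] at hev
  -- Either a factor common to `q` and `c` hides the root from the closed-loop transfer function, or
  -- the root is a genuine pole. A hidden root must be `β` with `η = β (1 + η)`, which is what `hβ`
  -- covers.
  rcases mul_eq_zero.1 hev.symm with h0 | h0
  · have hqz : (z - 1) * (z - β) = 0 := by simpa [hqdef] using h0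
    rw [hqz, zero_add] at hz
    have hN : (1 + η) * z - η = 0 := by
      refine (mul_eq_zero.1 hz).resolve_left ?_
      exact_mod_cast mul_ne_zero hκ hα
    rcases mul_eq_zero.1 hqz with h1 | h1
    · rw [sub_eq_zero.1 h1] at hN
      norm_num at hN
    · rw [sub_eq_zero.1 h1] at hN ⊢
      have : η = β * (1 + η) := by
        have : (1 + η) * β - η = 0 := by exact_mod_cast hN
        linarith
      simpa using hβ this
  · exact hstable.poles z h0

/-- The symbol of `u - m y` in terms of the state. -/
noncomputable def symbolQ (α β η m : ℝ) (z : ℂ) : ℂ :=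
  -((z - 1) * (z - β) / α) - m * ((1 + η) * z - η)

/-- The symbol of `L y - u` in terms of the state. -/
noncomputable def symbolP (α β η L : ℝ) (z : ℂ) : ℂ :=
  L * ((1 + η) * z - η) + (z - 1) * (z - β) / α

/-- The quadratic form of the multiplier equals `2 Re ((1 - H) (1 - m g)^* (L g - 1))`. Multiplying
by `|D / α|²`, with `D = (z - 1) (z - β)`, clears the denominators and gives an expression
continuous on the whole circle. -/
lemma FDI.re_lt_zero {α β η m L : ℝ} (hα : α ≠ 0) {h : ℤ → ℝ}
    (hFDI : FDI m L h (transferFunction α β η)) {z : ℂ} (hz : ‖z‖ = 1)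
    (hD : (z - 1) * (z - β) ≠ 0) :
    ((1 - zTransform h z) * (star (symbolQ α β η m z) * symbolP α β η L z)).re < 0 := by
  obtain ⟨hroot, heval⟩ := transferFunction_eval α β η hD
  have hlt := hFDI z hz hroot
  rw [heval] at hlt
  set D := (z - 1) * (z - β) with hDdef
  set N := (1 + η) * z - η with hN
  set H := zTransform h z with hH
  set g := -α * N / D with hg
  have hα' : (α : ℂ) ≠ 0 := by exact_mod_cast hα
  have hQ : 1 - m * g = -α / D * symbolQ α β η m z := by
    rw [symbolQ, ← hDdef, ← hN, hg]; field_simp; ring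
  have hP : L * g - 1 = -α / D * symbolP α β η L z := by
    rw [symbolP, ← hDdef, ← hN, hg]; field_simp; ring
  have hform : (star ![g, 1] ⬝ᵥ (multiplier m L h z *ᵥ ![g, 1])).re
      = 2 * ((1 - H) * (star (1 - m * g) * (L * g - 1))).re := by
    have hmul : multiplier m L h z = !![-(m * L) * (2 - H - star H), L * (1 - star H) + m * (1 - H);
     L * (1 - H) + m * (1 - star H), -(2 - H - star H)] := rfl
    rw [hmul]
    have h2 : ∀ w : ℂ, 2 * w.re = (w + star w).re := fun w => by simp; ring
    rw [h2]
    congr 1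
    simp [Matrix.mulVec, dotProduct, Fin.sum_univ_two]
    ring
  rw [hform, hQ, hP] at hlt
  have hcoef : 0 < Complex.normSq (-α / D) :=
    Complex.normSq_pos.2 (div_ne_zero (neg_ne_zero.2 hα') hD)
  have hfac : (1 - H) * (star (-α / D * symbolQ α β η m z) * (-α / D * symbolP α β η L z))
      = (Complex.normSq (-α / D) : ℂ)
        * ((1 - H) * (star (symbolQ α β η m z) * symbolP α β η L z)) := by
    rw [← Complex.mul_conj, star_mul', starRingEnd_apply]; ring
  rw [hfac, Complex.re_ofReal_mul] at hlt
  by_contra hcon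
  push Not at hcon
  nlinarith [mul_nonneg hcoef.le hcon]

/-- The frequency inequality is silent at poles of `g`; there the symbols reduce to `-m N` and `L
N`, with `N = (1 + η) z - η`. -/
lemma re_star_symbolQ_mul_symbolP_of_pole {α β η m L : ℝ} (z : ℂ)
    (hD : (z - 1) * (z - β) = 0) :
    star (symbolQ α β η m z) * symbolP α β η L z
      = ((-(m * L * Complex.normSq ((1 + η) * z - η)) : ℝ) : ℂ) := by
  rw [symbolQ, symbolP, hD]
  push_cast
  rw [← Complex.mul_conj, starRingEnd_apply]
  simp
  ring

variable {h : ℤ → ℝ}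

lemma IsZamesFalb.summable' (hh : IsZamesFalb h) : Summable h := by
  simpa [abs_of_nonneg, hh.nonneg] using hh.summable

lemma IsZamesFalb.tsum_le_one (hh : IsZamesFalb h) : ∑' k, h k ≤ 1 := by
  simpa [abs_of_nonneg, hh.nonneg] using hh.norm_le_one

lemma IsZamesFalb.norm_term (hh : IsZamesFalb h) (z : Circle) (k : ℤ) :
    ‖(h k : ℂ) * (z : ℂ) ^ (-k)‖ = h k := by
  rw [norm_mul, norm_zpow, Circle.norm_coe]
  simp [abs_of_nonneg (hh.nonneg k)]

lemma IsZamesFalb.norm_zTransform_le (hh : IsZamesFalb h) (z : Circle) :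
    ‖zTransform h z‖ ≤ 1 := by
  have hs : Summable fun k => ‖(h k : ℂ) * (z : ℂ) ^ (-k)‖ := by
    simpa only [hh.norm_term] using hh.summable'
  refine (norm_tsum_le_tsum_norm hs).trans ?_
  simpa only [hh.norm_term] using hh.tsum_le_one

lemma IsZamesFalb.norm_zTransform_sub_sum_le (hh : IsZamesFalb h) (J : Finset ℤ) (z : Circle) :
    ‖zTransform h z - ∑ k ∈ J, (h k : ℂ) * (z : ℂ) ^ (-k)‖ ≤ ∑' k, h k - ∑ k ∈ J, h k := by
  have hs : Summable fun k => ‖(h k : ℂ) * (z : ℂ) ^ (-k)‖ := by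
    simpa only [hh.norm_term] using hh.summable'
  have h1 := hs.of_norm.sum_add_tsum_compl (s := J)
  have h2 := hh.summable'.sum_add_tsum_compl (s := J)
  rw [zTransform, ← h1, ← h2, add_sub_cancel_left, add_sub_cancel_left]
  refine (norm_tsum_le_tsum_norm (hs.subtype _)).trans (le_of_eq ?_)
  simp only [hh.norm_term]

lemma IsZamesFalb.continuous_zTransform (hh : IsZamesFalb h) :
    Continuous fun z : Circle => zTransform h z := by
  refine continuous_tsum (fun k => ?_) hh.summable' (fun k z => (hh.norm_term z k).le)
  exact continuous_const.mul
    (Continuous.zpow₀ (by fun_prop) _ fun z => Or.inl (Circle.coe_ne_zero _))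

lemma exists_uniform_combination {X : Type*} [TopologicalSpace X] [CompactSpace X] [Nonempty X]
    {a b : X → ℝ} (ha : Continuous a) (hb : Continuous b) (ha₀ : ∀ x, a x ≤ 0)
    (hab : ∀ x, a x < 0 ∨ b x < 0) :
    ∃ ε c : ℝ, 0 < ε ∧ ε < 1 ∧ 0 < c ∧ ∀ x, (1 - ε) * a x + ε * b x ≤ -c := by
  have hex : ∃ ε : ℝ, 0 < ε ∧ ε < 1 ∧ ∀ x, (1 - ε) * a x + ε * b x < 0 := by
    have hcomp : IsCompact {x | 0 ≤ b x} := (isClosed_le continuous_const hb).isCompact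
    have hpos : ∀ x, b x < 0 → ∀ ε : ℝ, 0 < ε → ε < 1 → (1 - ε) * a x + ε * b x < 0 :=
      fun x hx ε h0 h1 => by nlinarith [ha₀ x, mul_neg_of_pos_of_neg h0 hx]
    rcases Set.eq_empty_or_nonempty {x | 0 ≤ b x} with he | hne
    · refine ⟨1 / 2, by norm_num, by norm_num, fun x => hpos x ?_ _ (by norm_num) (by norm_num)⟩
      by_contra hx
      exact (Set.eq_empty_iff_forall_notMem.1 he x) (not_lt.1 hx)
    obtain ⟨x₁, hx₁, hmax₁⟩ := hcomp.exists_isMaxOn hne ha.continuousOn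
    obtain ⟨x₂, hx₂, hmax₂⟩ := hcomp.exists_isMaxOn hne hb.continuousOn
    have h1 : a x₁ < 0 := (hab x₁).resolve_right (not_lt.2 hx₁)
    have h2 : 0 ≤ b x₂ := hx₂
    -- The weight `ε = -a x₁ / (b x₂ - 2 a x₁)` solves `(1 - ε) a x₁ + ε b x₂ = ε a x₁`, so the
    -- worst case on `{b ≥ 0}` is still negative.
    have hden : 0 < b x₂ - 2 * a x₁ := by linarith
    have hlt : -a x₁ / (b x₂ - 2 * a x₁) < 1 := by rw [div_lt_one hden]; linarith
    have hpo : 0 < -a x₁ / (b x₂ - 2 * a x₁) := div_pos (by linarith) hden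
    refine ⟨_, hpo, hlt, fun x => ?_⟩
    rcases lt_or_ge (b x) 0 with hx | hx
    · exact hpos x hx _ hpo hlt
    · have h3 : a x ≤ a x₁ := hmax₁ hx
      have h4 : b x ≤ b x₂ := hmax₂ hx
      set ε := -a x₁ / (b x₂ - 2 * a x₁) with hε
      have h5 : ε * (b x₂ - 2 * a x₁) = -a x₁ := div_mul_cancel₀ _ hden.ne'
      nlinarith
  obtain ⟨ε, h0, h1, hneg⟩ := hex
  obtain ⟨x₀, -, hx₀⟩ := isCompact_univ.exists_isMaxOn Set.univ_nonempty
    (f := fun x => (1 - ε) * a x + ε * b x) (by fun_prop)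
  refine ⟨ε, -((1 - ε) * a x₀ + ε * b x₀), h0, h1, by linarith [hneg x₀], fun x => ?_⟩
  have := hx₀ (Set.mem_univ x)
  simp only [Set.mem_ofPred_eq] at this
  linarith

/-- A strict frequency-domain inequality may be assumed uniform, with a multiplier of finite
support. -/
lemma FDI.exists_uniform {α β η m L : ℝ} (hm : 0 < m) (hmL : m ≤ L) (hα : α ≠ 0)
    (hβ : η = β * (1 + η) → |β| < 1) (hh : IsZamesFalb h)
    (hFDI : FDI m L h (transferFunction α β η)) :
    ∃ (J : Finset ℤ) (h' : ℤ → ℝ) (c : ℝ), (∀ j, 0 ≤ h' j) ∧ ∑ j ∈ J, h' j ≤ 1 ∧ 0 < c ∧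
      ∀ z : Circle, ((1 - ∑ j ∈ J, (h' j : ℂ) * (z : ℂ) ^ (-j))
        * (star (symbolQ α β η m z) * symbolP α β η L z)).re ≤ -c := by
  set w : Circle → ℂ := fun z => star (symbolQ α β η m z) * symbolP α β η L z with hw
  have hwc : Continuous w := by
    simp only [hw, symbolQ, symbolP]
    fun_prop
  have hpole : ∀ z : Circle, ((z : ℂ) - 1) * (z - β) = 0 →
      ∃ r : ℝ, r < 0 ∧ w z = r := by
    intro z hz
    refine ⟨_, ?_, re_star_symbolQ_mul_symbolP_of_pole (z : ℂ) hz⟩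
    have hN : (1 + η) * (z : ℂ) - η ≠ 0 := by
      intro hN
      rcases mul_eq_zero.1 hz with h1 | h1
      · rw [sub_eq_zero.1 h1] at hN
        norm_num at hN
      · have hzb := sub_eq_zero.1 h1
        rw [hzb] at hN
        have h2 : η = β * (1 + η) := by
          have : (1 + η) * β - η = 0 := by exact_mod_cast hN
          linarith
        have h3 := hβ h2
        have h4 : ‖(z : ℂ)‖ = 1 := Circle.norm_coe z
        rw [hzb, Complex.norm_real, Real.norm_eq_abs] at h4
        linarith
    have := Complex.normSq_pos.2 hN
    have hL : 0 < L := hm.trans_le hmL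
    have : 0 < m * L * Complex.normSq ((1 + η) * (z : ℂ) - η) := by positivity
    linarith
  have hHre : ∀ z : Circle, (zTransform h z).re ≤ 1 := fun z =>
    (Complex.re_le_norm _).trans (hh.norm_zTransform_le z)
  -- Strictness may fail at a pole, for instance at `z = 1` when `∑ h_k = 1`.
  have ha₀ : ∀ z : Circle, ((1 - zTransform h z) * w z).re ≤ 0 := by
    intro z
    by_cases hz : ((z : ℂ) - 1) * (z - β) = 0
    · obtain ⟨r, hr, hrw⟩ := hpole z hz
      rw [hrw, Complex.re_mul_ofReal, Complex.sub_re, Complex.one_re]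
      nlinarith [hHre z]
    · exact (hFDI.re_lt_zero hα (Circle.norm_coe z) hz).le
  have hab : ∀ z : Circle, ((1 - zTransform h z) * w z).re < 0 ∨ (w z).re < 0 := by
    intro z
    by_cases hz : ((z : ℂ) - 1) * (z - β) = 0
    · obtain ⟨r, hr, hrw⟩ := hpole z hz
      exact Or.inr (by simpa [hrw] using hr)
    · exact Or.inl (hFDI.re_lt_zero hα (Circle.norm_coe z) hz)
  -- Mixing in the multiplier `h = 0`, which is strict at the poles, replaces `h` by `(1 - ε) h`.
  obtain ⟨ε, c, hε₀, hε₁, hc, hle⟩ := exists_uniform_combination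
    (Complex.continuous_re.comp ((continuous_const.sub hh.continuous_zTransform).mul hwc))
    (Complex.continuous_re.comp hwc) ha₀ hab
  obtain ⟨B, hB⟩ := isCompact_univ.exists_bound_of_continuousOn hwc.continuousOn
  have hB' : ∀ z, ‖w z‖ ≤ |B| + 1 := fun z => by
    linarith [hB z (Set.mem_univ z), le_abs_self B]
  have hBpos : 0 < |B| + 1 := by positivity
  -- The tail of `h` outside `J` is small enough to cost at most half of the margin `c`.
  obtain ⟨J, hJ⟩ := ((hh.summable'.hasSum.eventually
    (lt_mem_nhds (show ∑' k, h k - c / (2 * (|B| + 1)) < ∑' k, h k by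
      have : 0 < c / (2 * (|B| + 1)) := by positivity
      linarith)))).exists
  refine ⟨J, fun j => (1 - ε) * h j, c / 2, fun j => mul_nonneg (by linarith) (hh.nonneg j), ?_,
    by positivity, fun z => ?_⟩
  · rw [← Finset.mul_sum]
    have h1 : ∑ j ∈ J, h j ≤ 1 :=
      (hh.summable'.sum_le_tsum J fun j _ => hh.nonneg j).trans hh.tsum_le_one
    have h2 : 0 ≤ ∑ j ∈ J, h j := Finset.sum_nonneg fun j _ => hh.nonneg j
    nlinarith
  · set R := zTransform h z - ∑ k ∈ J, (h k : ℂ) * (z : ℂ) ^ (-k) with hR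
    have hRle : ‖R‖ ≤ c / (2 * (|B| + 1)) :=
      (hh.norm_zTransform_sub_sum_le J z).trans (by linarith)
    have hsplit : (1 - ∑ j ∈ J, (((1 - ε) * h j : ℝ) : ℂ) * (z : ℂ) ^ (-j)) * w z
        = ((1 - ε : ℝ) : ℂ) * ((1 - zTransform h z) * w z) + (ε : ℂ) * w z
          + ((1 - ε : ℝ) : ℂ) * (R * w z) := by
      have : ∑ j ∈ J, (((1 - ε) * h j : ℝ) : ℂ) * (z : ℂ) ^ (-j)
          = ((1 - ε : ℝ) : ℂ) * ∑ j ∈ J, (h j : ℂ) * (z : ℂ) ^ (-j) := by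
        rw [Finset.mul_sum]
        refine Finset.sum_congr rfl fun j _ => ?_
        push_cast; ring
      rw [this, hR]
      push_cast
      ring
    have h1 : (1 - ε) * ((1 - zTransform h z) * w z).re + ε * (w z).re ≤ -c := hle z
    have h2 : ‖R * w z‖ ≤ c / 2 := by
      rw [norm_mul]
      calc ‖R‖ * ‖w z‖ ≤ c / (2 * (|B| + 1)) * (|B| + 1) := by
            gcongr
            exact hB' z
        _ = c / 2 := by field_simp
    have h3 : (R * w z).re ≤ c / 2 := (Complex.re_le_norm _).trans h2
    have h4 : (1 - ε) * (R * w z).re ≤ c / 2 := by nlinarith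
    change ((1 - ∑ j ∈ J, (((1 - ε) * h j : ℝ) : ℂ) * (z : ℂ) ^ (-j)) * w z).re ≤ _
    rw [hsplit, Complex.add_re, Complex.add_re, Complex.re_ofReal_mul, Complex.re_ofReal_mul,
      Complex.re_ofReal_mul]
    linarith

end Frequency

/-! ### Forced trajectories and perturbation of the gradient map -/

section Dynamics

variable {E : Type*} [NormedAddCommGroup E] [InnerProductSpace ℝ E]

/-- The point at which the gradient is evaluated at time `k`. -/
def output (η : ℝ) (x : ℤ → E) (k : ℤ) : E := x k + η • (x k - x (k - 1))

/-- `x` solves the recursion of the algorithm with gradient map `G` and additive input `r`. -/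
def SolvesRecursion (α β η : ℝ) (G : E → E) (r x : ℤ → E) : Prop :=
  ∀ k, x (k + 1) = x k + β • (x k - x (k - 1)) - α • G (output η x k) + r k

/-- Solutions of the recursion that start at rest at time `0`. -/
structure IsTrajectory (α β η : ℝ) (G : E → E) (r x : ℤ → E) : Prop where
  rest : ∀ k ≤ 0, x k = 0
  recursion : SolvesRecursion α β η G r x

/-- Square-summable inputs produce square-summable trajectories. -/
def L2Stable (α β η : ℝ) (G : E → E) : Prop :=
  ∀ r x : ℤ → E, (∀ k < 0, r k = 0) → Memℓp r 2 → IsTrajectory α β η G r x → Memℓp x 2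

/-- State `(x_n, x_{n-1})` of the trajectory driven by `r`. -/
noncomputable def forcedState (α β η : ℝ) (G : E → E) (r : ℤ → E) : ℕ → E × E
  | 0 => (0, 0)
  | n + 1 =>
    let p := forcedState α β η G r n
    (p.1 + β • (p.1 - p.2) - α • G (p.1 + η • (p.1 - p.2)) + r n, p.1)

lemma exists_isTrajectory (α β η : ℝ) {G : E → E} (hG : G 0 = 0) {r : ℤ → E}
    (hr : ∀ k < 0, r k = 0) : ∃ x, IsTrajectory α β η G r x := by
  set st := forcedState α β η G r with hst
  have h0 : ∀ k : ℤ, k ≤ 0 → (st k.toNat).1 = 0 := fun k hk => by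
    rw [Int.toNat_of_nonpos hk]; rfl
  refine ⟨fun k => (st k.toNat).1, h0, fun k => ?_⟩
  rcases lt_or_ge k 0 with hk | hk
  · have h1 := h0 k hk.le
    have h2 := h0 (k - 1) (by omega)
    have h3 := h0 (k + 1) (by omega)
    simp only [output, h1, h2, h3, hr k hk]
    simp [hG]
  · lift k to ℕ using hk
    have h1 : (st ((k : ℤ) - 1).toNat).1 = (st k).2 := by
      cases k with
      | zero => rfl
      | succ n =>
        have : ((n + 1 : ℕ) - 1 : ℤ).toNat = n := by omega
        rw [this]; rfl
    have h2 : ((k : ℤ) + 1).toNat = k + 1 := by omega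
    simp only [output, h1, h2, Int.toNat_natCast]
    rfl

lemma isTrajectory_eq_of_le {α β η : ℝ} {G : E → E} {r x x' : ℤ → E}
    (hx₀ : ∀ k ≤ 0, x k = 0) (N : ℤ)
    (hx : ∀ k ≤ N, x (k + 1) = x k + β • (x k - x (k - 1)) - α • G (output η x k) + r k)
    (hx' : IsTrajectory α β η G r x') {k : ℤ} (hk : k ≤ N + 1) : x' k = x k := by
  have key : ∀ n : ℕ, (n : ℤ) ≤ N + 1 → ∀ k ≤ (n : ℤ), x' k = x k := by
    intro n
    induction n with
    | zero => exact fun _ k hk => by rw [hx₀ k (by simpa using hk), hx'.rest k (by simpa using hk)]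
    | succ n ih =>
      intro hn k hk
      have ih' := ih (by omega)
      rcases (show k ≤ n ∨ k = n + 1 by omega) with h | rfl
      · exact ih' k h
      · rw [hx'.recursion, hx n (by omega)]
        simp only [output, ih' n le_rfl, ih' (n - 1) (by omega)]
  rcases le_or_gt k 0 with h | h
  · rw [hx₀ k h, hx'.rest k h]
  · exact key k.toNat (by omega) k (by omega)

lemma SeqL2.norm_le_mul_of_forall {F : Type*} [NormedAddCommGroup F] {a b : SeqL2 F} {c : ℝ} (hc : 0 ≤ c)
    (hab : ∀ k, ‖a k‖ ≤ c * ‖b k‖) : ‖a‖ ≤ c * ‖b‖ := by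
  refine (sq_le_sq₀ (norm_nonneg _) (by positivity)).1 ?_
  rw [mul_pow]
  refine hasSum_le (fun k => ?_) (SeqL2.hasSum_norm_sq a)
    ((SeqL2.hasSum_norm_sq b).mul_left (c ^ 2))
  rw [← mul_pow]
  exact pow_le_pow_left₀ (norm_nonneg _) (hab k) 2

/-- The output sequence of a square-summable state sequence. -/
noncomputable def outputSeq (η : ℝ) (x : SeqL2 E) : SeqL2 E := (1 + η) • x - η • shift 1 x

lemma outputSeq_apply (η : ℝ) (x : SeqL2 E) (k : ℤ) : outputSeq η x k = output η x k := by
  simp only [outputSeq, output, SeqL2.sub_apply, SeqL2.smul_apply, shift_apply]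
  module

lemma norm_outputSeq_le (η : ℝ) (x : SeqL2 E) : ‖outputSeq η x‖ ≤ (1 + 2 * |η|) * ‖x‖ := by
  refine (norm_sub_le _ _).trans ?_
  rw [norm_smul, norm_smul, LinearIsometry.norm_map, Real.norm_eq_abs, Real.norm_eq_abs]
  have : |1 + η| ≤ 1 + |η| := by simpa using abs_add_le 1 η
  nlinarith [norm_nonneg x]

/-- A-priori `ℓ²` gain bound for a gradient map. -/
def GainBound (α β η K : ℝ) (G : E → E) : Prop :=
  ∀ r x : SeqL2 E, SolvesRecursion α β η G r x → ‖x‖ ≤ K * ‖r‖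

/-- `ℓ²` stability persists under small perturbations of a gradient map with a gain bound. -/
lemma L2Stable.perturb {α β η K δ : ℝ} (hK : 0 ≤ K) (hδ : 0 ≤ δ) {G G' : E → E} (hG : G 0 = 0)
    (hstab : L2Stable α β η G) (hgain : GainBound α β η K G)
    (hclose : ∀ a, ‖G' a - G a‖ ≤ δ * ‖a‖) (hsmall : K * (|α| * δ * (1 + 2 * |η|)) ≤ 1 / 2) :
    L2Stable α β η G' := by
  intro r x hr hr2 hx
  set R : SeqL2 E := ⟨r, hr2⟩ with hR
  -- Since `x` is not yet known to be in `ℓ²`, the gradient discrepancy is cut off after time `N`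
  -- and treated as an input `e` to the loop with `G`. That loop's response is in `ℓ²` and agrees
  -- with `x` up to `N + 1` by causality. The gain bound then applies, and `hsmall` absorbs `K ‖e‖`
  -- into `‖X‖ / 2`, uniformly in `N`.
  have hbound : ∀ N : ℤ, ∃ X : SeqL2 E, ‖X‖ ≤ 2 * K * ‖R‖ ∧ ∀ k ≤ N, X k = x k := by
    intro N
    set e : ℤ → E := fun k => if k ≤ N then α • (G' (output η x k) - G (output η x k)) else 0
      with he
    have hout0 : ∀ k ≤ 0, output η x k = 0 := fun k hk => by
      simp [output, hx.rest k hk, hx.rest (k - 1) (by omega)]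
    have hclose0 : ∀ k ≤ 0, e k = 0 := fun k hk => by
      have := hclose 0
      simp only [norm_zero, mul_zero, norm_le_zero_iff] at this
      simp only [he, hout0 k hk, this, smul_zero, ite_self]
    have he2 : Memℓp e 2 := by
      rw [memℓp_two_iff]
      refine summable_of_hasFiniteSupport ((Set.finite_Icc 0 N).subset fun k hk => ?_)
      by_contra hcon
      refine hk ?_
      rcases le_or_gt k 0 with h | h
      · simp [hclose0 k h]
      · have : ¬ k ≤ N := fun h' => hcon ⟨h.le, h'⟩
        simp [he, this]
    have hr' : ∀ k < 0, (r - e) k = 0 := fun k hk => by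
      simp [hr k hk, hclose0 k hk.le]
    obtain ⟨x', hx'⟩ := exists_isTrajectory α β η hG hr'
    have hx'2 : Memℓp x' 2 := hstab _ _ hr' (hr2.sub he2) hx'
    have heq : ∀ k ≤ N + 1, x' k = x k := fun k hk => by
      refine isTrajectory_eq_of_le hx.rest N (fun k hk => ?_) hx' hk
      rw [hx.recursion k]
      simp only [Pi.sub_apply, he, hk, if_true]
      module
    set X : SeqL2 E := ⟨x', hx'2⟩ with hX
    set e' : SeqL2 E := ⟨e, he2⟩ with he'
    have h1 : ‖X‖ ≤ K * ‖R - e'‖ := hgain (R - e') X hx'.recursion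
    have h2 : ‖e'‖ ≤ |α| * δ * ‖outputSeq η X‖ := by
      refine SeqL2.norm_le_mul_of_forall (by positivity) fun k => ?_
      change ‖e k‖ ≤ _
      by_cases hk : k ≤ N
      · have h3 : outputSeq η X k = output η x k := by
          rw [outputSeq_apply]
          simp only [output, hX, heq k (by omega), heq (k - 1) (by omega)]
        simp only [he, hk, if_true, h3, norm_smul, Real.norm_eq_abs, mul_assoc]
        exact mul_le_mul_of_nonneg_left (hclose _) (abs_nonneg _)
      · simp only [he, hk, if_false, norm_zero]
        positivity
    have h3 := norm_outputSeq_le η X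
    refine ⟨X, ?_, fun k hk => heq k (by omega)⟩
    have h4 : ‖e'‖ ≤ |α| * δ * (1 + 2 * |η|) * ‖X‖ := by
      refine h2.trans ?_
      rw [mul_assoc (|α| * δ)]
      exact mul_le_mul_of_nonneg_left h3 (by positivity)
    have h5 : ‖X‖ ≤ K * ‖R‖ + K * ‖e'‖ := by
      rw [← mul_add]
      exact h1.trans (mul_le_mul_of_nonneg_left (norm_sub_le _ _) hK)
    have h6 : K * ‖e'‖ ≤ 1 / 2 * ‖X‖ := by
      refine (mul_le_mul_of_nonneg_left h4 hK).trans ?_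
      rw [← mul_assoc]
      exact mul_le_mul_of_nonneg_right hsmall (norm_nonneg _)
    linarith
  rw [memℓp_two_iff]
  refine summable_of_sum_le (c := (2 * K * ‖R‖) ^ 2) (fun k => sq_nonneg _) fun s => ?_
  obtain ⟨N, hN⟩ := s.bddAbove
  obtain ⟨X, hXle, hXeq⟩ := hbound N
  calc ∑ k ∈ s, ‖x k‖ ^ 2 = ∑ k ∈ s, ‖X k‖ ^ 2 :=
        Finset.sum_congr rfl fun k hk => by rw [hXeq k (hN hk)]
    _ ≤ ‖X‖ ^ 2 := sum_le_hasSum s (fun k _ => sq_nonneg _) (SeqL2.hasSum_norm_sq X)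
    _ ≤ (2 * K * ‖R‖) ^ 2 := pow_le_pow_left₀ (norm_nonneg _) hXle 2

end Dynamics

/-! ### Square-summability for the linear loop -/

section Filter

lemma summable_norm_sq_of_first_order {a b : ℕ → ℂ} {μ : ℂ} (hμ : ‖μ‖ < 1)
    (hab : ∀ n, a (n + 1) = μ * a n + b n) (hb : Summable fun n => ‖b n‖ ^ 2) :
    Summable fun n => ‖a n‖ ^ 2 := by
  set t := ‖μ‖ with ht
  have ht0 : 0 ≤ t := norm_nonneg μ
  have h1t : 0 < 1 - t := by linarith
  -- Convexity of the square with weights `t` and `1 - t`, applied to `‖a n‖` and `‖b n‖ / (1 - t)`.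
  have hstep : ∀ n, ‖a (n + 1)‖ ^ 2 ≤ t * ‖a n‖ ^ 2 + ‖b n‖ ^ 2 / (1 - t) := by
    intro n
    have h1 : ‖a (n + 1)‖ ≤ t * ‖a n‖ + ‖b n‖ := by
      rw [hab, ht, ← norm_mul]; exact norm_add_le _ _
    refine (pow_le_pow_left₀ (norm_nonneg _) h1 2).trans ?_
    set u := ‖a n‖
    set w := ‖b n‖
    have : t * u ^ 2 + w ^ 2 / (1 - t) - (t * u + w) ^ 2
        = t * ((1 - t) * u - w) ^ 2 / (1 - t) := by field_simp; ring
    have h2 : 0 ≤ t * ((1 - t) * u - w) ^ 2 / (1 - t) := by positivity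
    linarith
  set B := ‖a 0‖ ^ 2 + (∑' n, ‖b n‖ ^ 2) / (1 - t) with hB
  have hpartial : ∀ n, ∑ k ∈ Finset.range n, ‖a k‖ ^ 2 ≤ B / (1 - t) := by
    intro n
    have h1 : ∑ k ∈ Finset.range n, ‖a (k + 1)‖ ^ 2
        ≤ t * ∑ k ∈ Finset.range n, ‖a k‖ ^ 2 + (∑' n, ‖b n‖ ^ 2) / (1 - t) := by
      calc _ ≤ ∑ k ∈ Finset.range n, (t * ‖a k‖ ^ 2 + ‖b k‖ ^ 2 / (1 - t)) :=
            Finset.sum_le_sum fun k _ => hstep k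
        _ = t * ∑ k ∈ Finset.range n, ‖a k‖ ^ 2
            + (∑ k ∈ Finset.range n, ‖b k‖ ^ 2) / (1 - t) := by
            rw [Finset.sum_add_distrib, ← Finset.mul_sum, Finset.sum_div]
        _ ≤ _ := by
            gcongr
            exact hb.sum_le_tsum _ fun k _ => sq_nonneg _
    have h2 := Finset.sum_range_succ (fun k => ‖a k‖ ^ 2) n
    have h3 := Finset.sum_range_succ' (fun k => ‖a k‖ ^ 2) n
    rw [le_div_iff₀ h1t]
    nlinarith [sq_nonneg ‖a n‖]
  exact summable_of_sum_range_le (fun k => sq_nonneg _) hpartial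

/-- With `μ` and `ν` the characteristic roots, `a (n + 1) - ν a n` obeys a first-order recursion
with multiplier `μ`, so the first-order case applies twice. -/
lemma summable_norm_sq_of_second_order {a r : ℕ → ℂ} {t p : ℂ}
    (hroots : ∀ z : ℂ, z ^ 2 - t * z + p = 0 → ‖z‖ < 1)
    (ha : ∀ n, a (n + 2) = t * a (n + 1) - p * a n + r n) (hr : Summable fun n => ‖r n‖ ^ 2) :
    Summable fun n => ‖a n‖ ^ 2 := by
  obtain ⟨s, hs⟩ := IsAlgClosed.exists_pow_nat_eq (t ^ 2 - 4 * p) (n := 2) (by norm_num)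
  set μ := (t + s) / 2 with hμ
  set ν := (t - s) / 2 with hν
  have hμ1 : ‖μ‖ < 1 := hroots _ (by rw [hμ]; linear_combination hs / 4)
  have hν1 : ‖ν‖ < 1 := hroots _ (by rw [hν]; linear_combination hs / 4)
  have hb : Summable fun n => ‖a (n + 1) - ν * a n‖ ^ 2 := by
    refine summable_norm_sq_of_first_order hμ1 (fun n => ?_) hr
    rw [ha, hμ, hν]
    linear_combination -(a n) * hs / 4
  exact summable_norm_sq_of_first_order hν1 (fun n => by ring) hb

lemma summable_norm_sq_iff_nat {F : Type*} [NormedAddCommGroup F] {x : ℤ → F}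
    (hx : ∀ k < 0, x k = 0) :
    Memℓp x 2 ↔ Summable fun n : ℕ => ‖x n‖ ^ 2 := by
  rw [memℓp_two_iff]
  refine (Function.Injective.summable_iff (g := fun n : ℕ => (n : ℤ)) Nat.cast_injective ?_).symm
  intro k hk
  rcases lt_or_ge k 0 with h | h
  · simp [hx k h]
  · exact absurd ⟨k.toNat, by simpa using h⟩ hk

lemma l2Stable_smul {d : ℕ} {α β η κ : ℝ}
    (hroots : ∀ z : ℂ, (z - 1) * (z - β) + κ * α * ((1 + η) * z - η) = 0 → ‖z‖ < 1) :
    L2Stable α β η (fun a : EuclideanSpace ℝ (Fin d) => κ • a) := by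
  intro r x hr hr2 hx
  rw [summable_norm_sq_iff_nat hr] at hr2
  rw [summable_norm_sq_iff_nat fun k hk => hx.rest k hk.le]
  simp only [EuclideanSpace.norm_sq_eq]
  refine summable_sum fun i _ => ?_
  -- A scalar gain decouples the coordinates. The recursion for `x (n + 2)` is read at time `n + 1`,
  -- hence the shifted input.
  have hri : Summable fun n : ℕ => ‖((r (n + 1 : ℕ) i : ℝ) : ℂ)‖ ^ 2 := by
    have h1 := (summable_nat_add_iff 1).2 hr2
    refine .of_nonneg_of_le (fun n => sq_nonneg _) (fun n => ?_) h1
    rw [Complex.norm_real]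
    exact pow_le_pow_left₀ (norm_nonneg _) (PiLp.norm_apply_le _ i) 2
  have key := summable_norm_sq_of_second_order (a := fun n : ℕ => ((x n i : ℝ) : ℂ))
    (t := ((1 + β - κ * α * (1 + η) : ℝ) : ℂ)) (p := ((β - κ * α * η : ℝ) : ℂ))
    (fun z hz => hroots z (by rw [← hz]; push_cast; ring)) (fun n => ?_) hri
  · simpa using key
  · have h1 := congrArg (fun v => ((v i : ℝ) : ℂ)) (hx.recursion (n + 1))
    have h2 : ((n : ℤ) + 1 - 1) = n := by ring
    have h3 : ((n : ℤ) + 1 + 1) = ((n + 2 : ℕ) : ℤ) := by push_cast; ring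
    simp only [output, h2, h3] at h1
    simp only [PiLp.add_apply, PiLp.sub_apply, PiLp.smul_apply, smul_eq_mul] at h1
    push_cast at h1 ⊢
    rw [h1]
    ring

end Filter

/-! ### The uniform `ℓ²` gain bound -/

section Gain

open LaurentPolynomial

variable {d : ℕ}

lemma le_mul_of_sq_le {c K₁ K₂ u v : ℝ} (hc : 0 < c) (hK₁ : 0 ≤ K₁) (hK₂ : 0 ≤ K₂)
    (hv : 0 ≤ v) (h : c * u ^ 2 ≤ K₁ * (u * v) + K₂ * v ^ 2) :
    u ≤ ((K₁ + K₂) / c + 1) * v := by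
  have hq : 0 ≤ (K₁ + K₂) / c := by positivity
  rcases le_or_gt u v with huv | huv
  · nlinarith
  · have hu' : 0 < u := hv.trans_lt huv
    have h1 : c * u ≤ (K₁ + K₂) * v := by
      refine le_of_mul_le_mul_right ?_ hu'
      nlinarith [mul_nonneg hK₂ hv]
    have h2 : u ≤ (K₁ + K₂) / c * v := by
      rw [div_mul_eq_mul_div, le_div_iff₀ hc]; linarith
    linarith

/-- Zames–Falb bounds a form in `(x, r)` from below by `0`, while its part quadratic in `x` is at
most `-c ‖x‖²`; hence `c ‖x‖²` is bounded by cross terms and `‖r‖²`. The constant is chosen before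
`F` and `G`, as the homotopy requires. -/
lemma exists_gainBound {α β η m L c : ℝ} (hmL : m ≤ L) (hα : α ≠ 0) {J : Finset ℤ} {h : ℤ → ℝ}
    (h₀ : ∀ j, 0 ≤ h j) (h₁ : ∑ j ∈ J, h j ≤ 1) (hc : 0 < c)
    (hfreq : ∀ z : Circle, ((1 - ∑ j ∈ J, (h j : ℂ) * (z : ℂ) ^ (-j))
        * (star (symbolQ α β η m z) * symbolP α β η L z)).re ≤ -c) :
    ∃ K : ℝ, 0 ≤ K ∧ ∀ (F : EuclideanSpace ℝ (Fin d) → ℝ)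
      (G : EuclideanSpace ℝ (Fin d) → EuclideanSpace ℝ (Fin d)),
      QuadraticBounds m L F G → G 0 = 0 → GainBound α β η K G := by
  set DL : ℝ[T;T⁻¹] := T (-1) - C (1 + β) + C β * T 1 with hDL
  set NL : ℝ[T;T⁻¹] := C (1 + η) - C η * T 1 with hNL
  set QL : ℝ[T;T⁻¹] := -(C α⁻¹ * DL) - C m * NL with hQL
  set PL : ℝ[T;T⁻¹] := C L * NL + C α⁻¹ * DL with hPL
  set ML : ℝ[T;T⁻¹] := 1 - ∑ j ∈ J, C (h j) * T j with hML
  have hsym : ∀ z : Circle, (laurentEval z (invert QL * (ML * PL))).re ≤ -c := by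
    intro z
    have hz : (z : ℂ) ≠ 0 := Circle.coe_ne_zero z
    have hD : laurentEval z DL = (z : ℂ)⁻¹ * ((z - 1) * (z - β)) := by
      simp only [hDL, map_add, map_sub, map_mul, laurentEval_T, laurentEval_C, neg_neg, zpow_one,
        zpow_neg]
      push_cast
      field_simp
      ring
    have hN : laurentEval z NL = (z : ℂ)⁻¹ * ((1 + η) * z - η) := by
      simp only [hNL, map_sub, map_mul, laurentEval_T, laurentEval_C, zpow_one, zpow_neg]
      push_cast
      field_simp
    have hQ : laurentEval z QL = (z : ℂ)⁻¹ * symbolQ α β η m z := by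
      simp only [hQL, map_neg, map_sub, map_mul, laurentEval_C, hD, hN, symbolQ]
      push_cast
      ring
    have hP : laurentEval z PL = (z : ℂ)⁻¹ * symbolP α β η L z := by
      simp only [hPL, map_add, map_mul, laurentEval_C, hD, hN, symbolP]
      push_cast
      ring
    have hM : laurentEval z ML = 1 - ∑ j ∈ J, (h j : ℂ) * (z : ℂ) ^ (-j) := by
      simp only [hML, map_sub, map_one, map_sum, map_mul, laurentEval_C, laurentEval_T]
    -- The recursion is centred at time `k`, so each symbol carries an extra `z⁻¹`; the two cancel
    -- in the Hermitian product.
    have hzz : star (z : ℂ)⁻¹ * (z : ℂ)⁻¹ = 1 := by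
      rw [← Circle.coe_inv]
      have := Complex.mul_conj ((z⁻¹ : Circle) : ℂ)
      rw [Circle.normSq_coe, mul_comm] at this
      simpa using this
    refine le_trans (le_of_eq ?_) (hfreq z)
    rw [map_mul, map_mul, laurentEval_invert, hQ, hP, hM, star_mul']
    congr 1
    linear_combination (1 - ∑ j ∈ J, (h j : ℂ) * (z : ℂ) ^ (-j))
      * (star (symbolQ α β η m z) * symbolP α β η L z) * hzz
  set A := laurentAct (EuclideanSpace ℝ (Fin d)) QL with hA
  set B := laurentAct (EuclideanSpace ℝ (Fin d)) PL with hB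
  set M := laurentAct (EuclideanSpace ℝ (Fin d)) ML with hM
  refine ⟨(|α⁻¹| * (‖A‖ * ‖M‖ + ‖M‖ * ‖B‖) + |α⁻¹| ^ 2 * ‖M‖) / c + 1, by positivity,
    fun F G hFG hG r x hx => ?_⟩
  have hDx : ∀ k, laurentAct (EuclideanSpace ℝ (Fin d)) DL x k
      = x (k + 1) - (1 + β) • x k + β • x (k - 1) := by
    intro k
    simp only [hDL, map_add, map_sub, map_mul, _root_.add_apply, _root_.sub_apply,
      mul_apply_eq_comp, laurentAct_C, laurentAct_T, SeqL2.add_apply, SeqL2.sub_apply,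
      SeqL2.smul_apply, shift_apply, sub_neg_eq_add]
    module
  have hNx : laurentAct (EuclideanSpace ℝ (Fin d)) NL x = outputSeq η x := by
    simp only [hNL, map_sub, map_mul, _root_.sub_apply, mul_apply_eq_comp, laurentAct_C,
      laurentAct_T, outputSeq]
  set D := laurentAct (EuclideanSpace ℝ (Fin d)) DL x with hD
  -- The gradient sequence, solved for from the recursion; this shows that it lies in `ℓ²`.
  set s : SeqL2 (EuclideanSpace ℝ (Fin d)) := α⁻¹ • (r - D) with hs
  have hsk : ∀ k, s k = G (outputSeq η x k) := by
    intro k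
    rw [outputSeq_apply, hs, SeqL2.smul_apply, SeqL2.sub_apply, hDx, hx k, inv_smul_eq_iff₀ hα]
    module
  have hzf := hFG.zamesFalb hmL hG h₀ h₁ (outputSeq η x) s hsk
  have hq : s - m • outputSeq η x = A x + α⁻¹ • r := by
    simp only [hA, hQL, map_neg, map_sub, map_mul, _root_.sub_apply, _root_.neg_apply,
      mul_apply_eq_comp, laurentAct_C, hNx, ← hD, hs]
    module
  have hp : L • outputSeq η x - s = B x - α⁻¹ • r := by
    simp only [hB, hPL, map_add, map_mul, _root_.add_apply,
      mul_apply_eq_comp, laurentAct_C, hNx, ← hD, hs]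
    module
  have hMv : ∀ u v : SeqL2 (EuclideanSpace ℝ (Fin d)), inner ℝ u (M v)
      = inner ℝ u v - ∑ j ∈ J, h j * inner ℝ u (shift j v) := by
    intro u v
    simp only [hM, hML, map_sub, map_one, map_sum, map_mul, _root_.sub_apply, one_apply_eq_self,
      _root_.sum_apply, mul_apply_eq_comp, laurentAct_C, laurentAct_T, inner_sub_right, inner_sum,
      real_inner_smul_right]
  rw [← hMv, hq, hp] at hzf
  have hmain : inner ℝ (A x) (M (B x)) ≤ -c * ‖x‖ ^ 2 := by
    have h1 := inner_laurentAct_le hsym x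
    rw [← inner_laurentAct_laurentAct, map_mul] at h1
    exact h1
  simp only [map_sub, map_smul, inner_add_left, inner_sub_right, real_inner_smul_left,
    real_inner_smul_right] at hzf
  have hMle : ∀ u v : SeqL2 (EuclideanSpace ℝ (Fin d)), |inner ℝ u (M v)| ≤ ‖u‖ * (‖M‖ * ‖v‖) :=
    fun u v => (abs_real_inner_le_norm _ _).trans
      (mul_le_mul_of_nonneg_left (M.le_opNorm v) (norm_nonneg _))
  have hb₁ : |α⁻¹ * inner ℝ (A x) (M r)| ≤ |α⁻¹| * (‖A‖ * ‖M‖ * (‖x‖ * ‖r‖)) := by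
    rw [abs_mul]
    refine mul_le_mul_of_nonneg_left ((hMle _ _).trans ?_) (abs_nonneg _)
    calc ‖A x‖ * (‖M‖ * ‖r‖) ≤ ‖A‖ * ‖x‖ * (‖M‖ * ‖r‖) := by gcongr; exact A.le_opNorm x
      _ = _ := by ring
  have hb₂ : |α⁻¹ * inner ℝ r (M (B x))| ≤ |α⁻¹| * (‖M‖ * ‖B‖ * (‖x‖ * ‖r‖)) := by
    rw [abs_mul]
    refine mul_le_mul_of_nonneg_left ((hMle _ _).trans ?_) (abs_nonneg _)
    calc ‖r‖ * (‖M‖ * ‖B x‖) ≤ ‖r‖ * (‖M‖ * (‖B‖ * ‖x‖)) := by gcongr; exact B.le_opNorm x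
      _ = _ := by ring
  have hb₃ : |α⁻¹ * (α⁻¹ * inner ℝ r (M r))| ≤ |α⁻¹| ^ 2 * ‖M‖ * ‖r‖ ^ 2 := by
    rw [abs_mul, abs_mul, ← mul_assoc]
    calc |α⁻¹| * |α⁻¹| * |inner ℝ r (M r)| ≤ |α⁻¹| * |α⁻¹| * (‖r‖ * (‖M‖ * ‖r‖)) := by
          gcongr; exact hMle _ _
      _ = _ := by ring
  refine le_mul_of_sq_le hc (by positivity) (by positivity) (norm_nonneg _) ?_
  have e₁ := abs_le.1 hb₁
  have e₂ := abs_le.1 hb₂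
  have e₃ := abs_le.1 hb₃
  nlinarith [e₁.1, e₂.2, e₃.1]

end Gain

/-! ### Homotopy from a linear gain to the gradient -/

section Homotopy

variable {d : ℕ}

/-- Every map on the segment from `κ •` to `G` satisfies the same quadratic bounds, so one gain `K`,
and hence one admissible step length, serves the whole segment. -/
lemma l2Stable_of_gainBound {α β η m L κ K B : ℝ} (hmκ : m ≤ κ) (hκL : κ ≤ L)
    (hroots : ∀ z : ℂ, (z - 1) * (z - β) + κ * α * ((1 + η) * z - η) = 0 → ‖z‖ < 1)
    (hK : 0 ≤ K)
    (hgain : ∀ (F : EuclideanSpace ℝ (Fin d) → ℝ)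
      (G : EuclideanSpace ℝ (Fin d) → EuclideanSpace ℝ (Fin d)),
      QuadraticBounds m L F G → G 0 = 0 → GainBound α β η K G)
    {F : EuclideanSpace ℝ (Fin d) → ℝ}
    {G : EuclideanSpace ℝ (Fin d) → EuclideanSpace ℝ (Fin d)} (hFG : QuadraticBounds m L F G)
    (hG : G 0 = 0) (hB : 0 ≤ B) (hGB : ∀ a, ‖G a - κ • a‖ ≤ B * ‖a‖) :
    L2Stable α β η G := by
  -- One step of length `1 / n` changes the map by at most `B / n`; this `n` makes the change meet
  -- the smallness condition of `L2Stable.perturb`.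
  obtain ⟨n, hn⟩ := exists_nat_gt (2 * (K * (|α| * B * (1 + 2 * |η|))))
  have hn0 : (0 : ℝ) < n := lt_of_le_of_lt (by positivity) hn
  set Gt : ℝ → EuclideanSpace ℝ (Fin d) → EuclideanSpace ℝ (Fin d) :=
    fun t a => (1 - t) • (κ • a) + t • G a with hGt
  have key : ∀ j : ℕ, j ≤ n → L2Stable α β η (Gt (j / n)) := by
    intro j
    induction j with
    | zero =>
      intro _
      have : Gt ((0 : ℕ) / n) = fun a => κ • a := by funext a; simp [hGt]
      rw [this]
      exact l2Stable_smul hroots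
    | succ j ih =>
      intro hj
      have ht₁ : (j : ℝ) / n ≤ 1 := by
        rw [div_le_one hn0]; exact_mod_cast (Nat.le_of_succ_le hj)
      have hQB := (QuadraticBounds.quadratic hmκ hκL).combination hFG (t := (j : ℝ) / n)
        (by positivity) ht₁
      have hGt0 : Gt (j / n) 0 = 0 := by simp [hGt, hG]
      refine L2Stable.perturb (δ := B / n) hK (by positivity) hGt0 (ih (Nat.le_of_succ_le hj))
        (hgain _ _ hQB hGt0) (fun a => ?_) ?_
      · have : Gt ((j + 1 : ℕ) / n) a - Gt (j / n) a = (1 / n : ℝ) • (G a - κ • a) := by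
          simp only [hGt]
          push_cast
          rw [add_div]
          module
        rw [this, norm_smul, Real.norm_of_nonneg (by positivity)]
        calc 1 / (n : ℝ) * ‖G a - κ • a‖ ≤ 1 / n * (B * ‖a‖) := by gcongr; exact hGB a
          _ = B / n * ‖a‖ := by ring
      · have : K * (|α| * (B / n) * (1 + 2 * |η|)) = K * (|α| * B * (1 + 2 * |η|)) / n := by ring
        rw [this, div_le_iff₀ hn0]
        linarith
  have h1 := key n le_rfl
  have h2 : Gt (n / n) = G := by funext a; simp [hGt, div_self hn0.ne']
  rwa [h2] at h1

end Homotopy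

/-! ### From `ℓ²` stability to global asymptotic stability -/

section Stability

variable {d : ℕ}

/-- The deviation of an orbit from `xs`, preceded by its initial condition and by zeros. -/
noncomputable def deviation (S : EuclideanSpace ℝ (Fin d) × EuclideanSpace ℝ (Fin d) →
    EuclideanSpace ℝ (Fin d) × EuclideanSpace ℝ (Fin d)) (xs : EuclideanSpace ℝ (Fin d))
    (q : EuclideanSpace ℝ (Fin d) × EuclideanSpace ℝ (Fin d)) (k : ℤ) :
    EuclideanSpace ℝ (Fin d) :=
  if k ≤ 0 then 0 else if k = 1 then q.2 - xs else (S^[(k - 2).toNat] q).1 - xs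

lemma deviation_add_two (S : EuclideanSpace ℝ (Fin d) × EuclideanSpace ℝ (Fin d) →
    EuclideanSpace ℝ (Fin d) × EuclideanSpace ℝ (Fin d)) (xs : EuclideanSpace ℝ (Fin d))
    (q : EuclideanSpace ℝ (Fin d) × EuclideanSpace ℝ (Fin d)) (n : ℕ) :
    deviation S xs q (n + 2) = (S^[n] q).1 - xs := by
  have h1 : ¬ ((n : ℤ) + 2 ≤ 0) := by omega
  have h2 : ¬ ((n : ℤ) + 2 = 1) := by omega
  simp [deviation, h1, h2]

lemma deviation_add_one (α β η : ℝ) (f : EuclideanSpace ℝ (Fin d) → ℝ)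
    (xs : EuclideanSpace ℝ (Fin d))
    (q : EuclideanSpace ℝ (Fin d) × EuclideanSpace ℝ (Fin d)) (n : ℕ) :
    deviation (step α β η f) xs q (n + 1) = ((step α β η f)^[n] q).2 - xs := by
  cases n with
  | zero => simp [deviation]
  | succ n =>
    have : (((n + 1 : ℕ) : ℤ) + 1) = n + 2 := by push_cast; ring
    rw [this, deviation_add_two, Function.iterate_succ_apply']
    rfl

lemma dist_iterate_eq (α β η : ℝ) (f : EuclideanSpace ℝ (Fin d) → ℝ)
    (xs : EuclideanSpace ℝ (Fin d))
    (q : EuclideanSpace ℝ (Fin d) × EuclideanSpace ℝ (Fin d)) (n : ℕ) :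
    dist ((step α β η f)^[n] q) (xs, xs)
      = max ‖deviation (step α β η f) xs q (n + 2)‖ ‖deviation (step α β η f) xs q (n + 1)‖ := by
  rw [deviation_add_two, deviation_add_one, Prod.dist_eq, dist_eq_norm, dist_eq_norm]

/-- The input that generates the initial condition of an orbit. -/
lemma exists_input_deviation (α β η : ℝ) {f : EuclideanSpace ℝ (Fin d) → ℝ}
    {xs : EuclideanSpace ℝ (Fin d)} {B : ℝ} (hB : 0 ≤ B)
    (hG : ∀ a, ‖∇ f (xs + a)‖ ≤ B * ‖a‖)
    (q : EuclideanSpace ℝ (Fin d) × EuclideanSpace ℝ (Fin d)) :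
    ∃ r : SeqL2 (EuclideanSpace ℝ (Fin d)), (∀ k < 0, r k = 0) ∧
      IsTrajectory α β η (fun a => ∇ f (xs + a)) r (deviation (step α β η f) xs q) ∧
      ‖r‖ ≤ (3 + |β| + |α| * B * (1 + |η|)) * dist q (xs, xs) := by
  set x := deviation (step α β η f) xs q with hx
  set G : EuclideanSpace ℝ (Fin d) → EuclideanSpace ℝ (Fin d) := fun a => ∇ f (xs + a) with hGdef
  have hG0 : G 0 = 0 := by simpa [hGdef] using hG 0
  have hx0 : ∀ k ≤ 0, x k = 0 := fun k hk => by simp [hx, deviation, hk]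
  have hx1 : x 1 = q.2 - xs := by simp [hx, deviation]
  have hx2 : x 2 = q.1 - xs := by simp [hx, deviation]
  -- From rest, the input `x 1` at time `0` produces `x 1`; the input `v` at time `1` corrects the
  -- next iterate to `x 2`. Afterwards the orbit runs unforced.
  set v := x 2 - (x 1 + β • x 1 - α • G (x 1 + η • x 1)) with hv
  set r : SeqL2 (EuclideanSpace ℝ (Fin d)) := lp.single 2 0 (x 1) + lp.single 2 1 v with hr
  have hrk : ∀ k, r k = (if k = 0 then x 1 else 0) + (if k = 1 then v else 0) := fun k => by
    rw [hr, SeqL2.add_apply, lp.single_apply, lp.single_apply, Pi.single_apply, Pi.single_apply]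
  refine ⟨r, fun k hk => ?_, ⟨hx0, fun k => ?_⟩, ?_⟩
  · rw [hrk, if_neg (by omega), if_neg (by omega), add_zero]
  · rw [hrk]
    rcases (show k < 0 ∨ k = 0 ∨ k = 1 ∨ 2 ≤ k by omega) with h | rfl | rfl | h
    · rw [if_neg (by omega), if_neg (by omega)]
      simp [output, hx0 (k + 1) (by omega), hx0 k (by omega), hx0 (k - 1) (by omega), hG0]
    · simp [output, hx0 0 le_rfl, hx0 (-1) (by omega), hG0]
    · simp [output, hx0 0 le_rfl, hv]
    · rw [if_neg (by omega), if_neg (by omega)]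
      obtain ⟨n, rfl⟩ : ∃ n : ℕ, k = n + 2 := ⟨(k - 2).toNat, by omega⟩
      have e1 : (n : ℤ) + 2 + 1 = ((n + 1 : ℕ) : ℤ) + 2 := by push_cast; ring
      have e2 : (n : ℤ) + 2 - 1 = n + 1 := by ring
      rw [output, e1, e2, hx, deviation_add_two, deviation_add_two, deviation_add_one,
        Function.iterate_succ_apply']
      set p := (step α β η f)^[n] q
      have e3 : xs + (p.1 - xs + η • (p.1 - xs - (p.2 - xs))) = p.1 + η • (p.1 - p.2) := by
        module
      simp only [hGdef, e3, step]
      module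
  · have hd : dist q (xs, xs) = max ‖x 2‖ ‖x 1‖ := by
      rw [hx1, hx2, Prod.dist_eq, dist_eq_norm, dist_eq_norm]
    have h1 : ‖x 1‖ ≤ dist q (xs, xs) := hd ▸ le_max_right _ _
    have h2 : ‖x 2‖ ≤ dist q (xs, xs) := hd ▸ le_max_left _ _
    set δ := dist q (xs, xs)
    have hsm : ∀ c : ℝ, ‖x 1 + c • x 1‖ ≤ (1 + |c|) * ‖x 1‖ := fun c => by
      refine (norm_add_le _ _).trans (le_of_eq ?_)
      rw [norm_smul, Real.norm_eq_abs]; ring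
    have h3 : ‖v‖ ≤ ‖x 2‖ + ((1 + |β|) * ‖x 1‖ + |α| * (B * ((1 + |η|) * ‖x 1‖))) := by
      refine (norm_sub_le _ _).trans (add_le_add le_rfl ((norm_sub_le _ _).trans
        (add_le_add (hsm β) ?_)))
      rw [norm_smul, Real.norm_eq_abs]
      exact mul_le_mul_of_nonneg_left ((hG _).trans (mul_le_mul_of_nonneg_left (hsm η) hB))
        (abs_nonneg _)
    calc ‖r‖ ≤ ‖x 1‖ + ‖v‖ := by
          refine (norm_add_le _ _).trans (le_of_eq ?_)
          rw [lp.norm_single (by norm_num), lp.norm_single (by norm_num)]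
      _ ≤ δ + (δ + ((1 + |β|) * δ + |α| * (B * ((1 + |η|) * δ)))) := by
          refine add_le_add h1 (h3.trans ?_)
          gcongr
      _ = _ := by ring

/-- The `ℓ²` norm dominates every term and is bounded by a multiple of the initial distance, which
gives Lyapunov stability; terms of a square-summable sequence tend to zero, which gives
attractivity. -/
lemma globallyAsymptoticallyStable_of_l2 {α β η K B : ℝ} {f : EuclideanSpace ℝ (Fin d) → ℝ}
    {xs : EuclideanSpace ℝ (Fin d)} (hK : 0 ≤ K) (hB : 0 ≤ B)
    (hG : ∀ a, ‖∇ f (xs + a)‖ ≤ B * ‖a‖)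
    (hstab : L2Stable α β η fun a => ∇ f (xs + a))
    (hgain : GainBound α β η K fun a => ∇ f (xs + a)) :
    GloballyAsymptoticallyStable (step α β η f) (xs, xs) := by
  have key : ∀ q, ∃ X : SeqL2 (EuclideanSpace ℝ (Fin d)),
      (∀ k, X k = deviation (step α β η f) xs q k) ∧
      ‖X‖ ≤ K * (3 + |β| + |α| * B * (1 + |η|)) * dist q (xs, xs) := by
    intro q
    obtain ⟨r, hr0, htraj, hrle⟩ := exists_input_deviation α β η hB hG q
    refine ⟨⟨_, hstab _ _ hr0 (lp.memℓp r) htraj⟩, fun k => rfl, ?_⟩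
    refine (hgain r _ htraj.recursion).trans ?_
    rw [mul_assoc]
    exact mul_le_mul_of_nonneg_left hrle hK
  refine ⟨?_, fun ε hε => ?_, fun q => ?_⟩
  · have : ∇ f xs = 0 := by simpa using hG 0
    simp [step, this]
  · set c := K * (3 + |β| + |α| * B * (1 + |η|)) with hc
    have hc0 : 0 ≤ c := by positivity
    refine ⟨ε / (c + 1), by positivity, fun q hq k => ?_⟩
    obtain ⟨X, hXk, hX⟩ := key q
    have h1 : ∀ j, ‖deviation (step α β η f) xs q j‖ ≤ ‖X‖ := fun j => by
      rw [← hXk]; exact lp.norm_apply_le_norm (by norm_num) X j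
    rw [dist_iterate_eq]
    refine (max_le (h1 _) (h1 _)).trans_lt ?_
    rw [lt_div_iff₀ (by positivity)] at hq
    have := dist_nonneg (x := q) (y := (xs, xs))
    nlinarith
  · obtain ⟨X, hXk, -⟩ := key q
    have hs := (SeqL2.hasSum_norm_sq X).summable.tendsto_cofinite_zero
    have h1 : ∀ j : ℕ, Tendsto (fun n : ℕ => ‖deviation (step α β η f) xs q (n + j)‖)
        atTop (𝓝 0) := by
      intro j
      have hinj : Function.Injective fun n : ℕ => (n : ℤ) + j := fun a b hab => by
        simpa using hab
      have h2 := (hs.comp (hinj.tendsto_cofinite)).sqrt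
      rw [Nat.cofinite_eq_atTop, Real.sqrt_zero] at h2
      refine h2.congr fun n => ?_
      simp only [Function.comp, Real.sqrt_sq (norm_nonneg _), hXk]
    rw [tendsto_iff_dist_tendsto_zero]
    simp only [dist_iterate_eq]
    simpa using (h1 2).max (h1 1)

end Stability

end GradAlg

/-- The hypotheses `hα` and `hβ` say that the realization of `g` by the algorithm has no hidden
mode on or outside the unit circle; they hold whenever this realization is minimal. -/
theorem mainTheorem3 (α β η m L : ℝ) (hm : 0 < m) (hmL : m ≤ L)
    (hα : α ≠ 0) (hβ : η = β * (1 + η) → |β| < 1)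
    (hstable : GradAlg.IsStable
      (1 - RatFunc.C (((L + m) / 2 : ℝ) : ℂ) * GradAlg.transferFunction α β η)⁻¹)
    (h : ℤ → ℝ) (hh : GradAlg.IsZamesFalb h)
    (hFDI : GradAlg.FDI m L h (GradAlg.transferFunction α β η))
    (d : ℕ) (f : EuclideanSpace ℝ (Fin d) → ℝ) (hf : GradAlg.SmoothStronglyConvex m L f) :
    ∃ xs : EuclideanSpace ℝ (Fin d), (∀ x, x ≠ xs → f xs < f x) ∧
      GradAlg.GloballyAsymptoticallyStable (GradAlg.step α β η f) (xs, xs) := by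
  obtain ⟨xs, hgrad, hmin⟩ := hf.exists_minimizer hm
  refine ⟨xs, hmin, ?_⟩
  have hL : 0 < L := hm.trans_le hmL
  obtain ⟨J, h', c, h₀, h₁, hc, hfreq⟩ := hFDI.exists_uniform hm hmL hα hβ hh
  obtain ⟨K, hK, hgain⟩ := GradAlg.exists_gainBound (d := d) hmL hα h₀ h₁ hc hfreq
  have hQB := hf.quadraticBounds.translate xs
  have hG0 : ∇ f (xs + 0) = 0 := by simpa using hgrad
  have hGB : ∀ a, ‖∇ f (xs + a)‖ ≤ L * ‖a‖ := fun a => by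
    simpa [hgrad] using hf.lipschitz_gradient (xs + a) xs
  have hroots : ∀ z : ℂ, (z - 1) * (z - β) + ((L + m) / 2 : ℝ) * α * ((1 + η) * z - η) = 0 →
      ‖z‖ < 1 := fun z hz =>
    GradAlg.norm_lt_one_of_charpoly_root hα (by positivity) hβ hstable hz
  -- The homotopy starts at the gain `κ = (L + m) / 2` of the stability hypothesis; `B = L + κ` is
  -- the triangle inequality for `‖G a - κ • a‖`.
  have hstab := GradAlg.l2Stable_of_gainBound (B := L + (L + m) / 2) (by linarith) (by linarith)
    hroots hK hgain hQB hG0 (by positivity) fun a => by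
      refine (norm_sub_le _ _).trans ?_
      rw [norm_smul, Real.norm_of_nonneg (by positivity), add_mul]
      exact add_le_add (hGB a) le_rfl
  exact GradAlg.globallyAsymptoticallyStable_of_l2 hK hL.le hGB hstab (hgain _ _ hQB hG0)
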